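/- Throughout, $R$ is a (commutative, unital) ordered ring, $C = R(i)$ with $i^2=-1$, and a $*$-algebra means an associative, not necessarily unital, algebra over $C$ with an antilinear involutive antiautomorphism $*$. A linear functional $\omega$ on a $*$-algebra $A$ is positive if $\omega(a^*a)\ge 0$ for all $a$; $a\in A$ is positive if $\omega(a)\ge0$ for all positive $\omega$. An $A$-valued inner product on a right $A$-module $E$ is a $C$-sesquilinear map $\langle\cdot,\cdot\rangle_A$ (linear in the second argument) with $\langle x,y\rangle_A=\langle y,x\rangle_A^*$ and $\langle x,y a\rangle_A=\langle x,y\rangle_A a$; it is non-degenerate if $\langle x,y\rangle_A=0$ for all $x$ implies $y=0$, and completely positive if $(\langle x_i,x_j\rangle_A)_{ij}$ is a positive element of $M_n(A)$ for all $n$ and $x_1,\dots,x_n\in E$. For left modules the same definitions apply with linearity in the first argument. Products of sets below, such as $B\cdot E$, denote $C$-linear spans. A pre-Hilbert $(A,D)$-bimodule is an $(A,D)$-bimodule $H$ with a non-degenerate, completely positive $D$-valued inner product such that $\langle a h,k\rangle_D=\langle h,a^*k\rangle_D$. $\mathrm{Rep}_D(A)$ is the category of pre-Hilbert $(A,D)$-bimodules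 $H$ with $A\cdot H=H$, with adjointable $A$-linear maps as morphisms. A strong Morita equivalence bimodule is a $(B,A)$-bimodule $E$ with $B\cdot E=E=E\cdot A$ and with completely positive non-degenerate inner products $\langle\cdot,\cdot\rangle_A$ and ${}_B\langle\cdot,\cdot\rangle$ such that $\langle bx,y\rangle_A=\langle x,b^*y\rangle_A$, ${}_B\langle xa,y\rangle={}_B\langle x,ya^*\rangle$, ${}_B\langle x,y\rangle z=x\langle y,z\rangle_A$, and the values of the two inner products span $A$ and $B$ over $C$, respectively. If such an $E$ exists, $A$ and $B$ are strongly Morita equivalent. Rieffel induction sends $H$ to $E\,\widehat\otimes_A H=(E\otimes_A H)/(E\otimes_A H)^\perp$, where $\langle x\otimes h,y\otimes k\rangle_D=\langle h,\langle x,y\rangle_A k\rangle_D$, and a morphism $T$ to the map induced by $\mathrm{id}\otimes T$. Theorem. (1) Strong Morita equivalence is an equivalence relation on the $*$-algebras $A$ over $C$ that are nondegenerate ($aA=0$ or $Aa=0$ implies $a=0$) and idempotent ($A\cdot A=A$). (2) If $E$ is a strong Morita equivalence $(B,A)$-bimodule, then for every $*$-algebra $D$ over $C$ the Rieffel induction functor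 $E\,\widehat\otimes_A-:\mathrm{Rep}_D(A)\to\mathrm{Rep}_D(B)$ is an equivalence of categories. (3) If $A$ and $B$ are unital and $E$ is a strong Morita equivalence $(B,A)$-bimodule, then there are finitely many $\xi_i,\eta_i\in E$ ($1\le i\le n$) and $x_j,y_j\in E$ ($1\le j\le m$) with $x=\sum_{i}\xi_i\langle\eta_i,x\rangle_A=\sum_{j}{}_B\langle x,y_j\rangle x_j$ for all $x\in E$; in particular $E$ is finitely generated and projective both as a right $A$-module and as a left $B$-module. (4) If $A$ and $B$ are unital and strongly Morita equivalent, then they are Morita equivalent: their categories of modules are ($C$-linearly, hence in particular additively) equivalent, so $A$ and $B$ are Morita equivalent as rings. -/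

import Mathlib

open scoped TensorProduct
open CategoryTheory

universe uR uA uB uD w

set_option linter.unusedSectionVars false

namespace StarMorita

noncomputable section

/-! ### The ring `C = R(i)` and positivity in `*`-algebras over it -/

section Positivity

/-- The extension `C = R(i)` of `R` by a square root `i` of `-1`: elements `re + im * i` with
`i * i = -1`. Its `star` is the conjugation `re + im * i ↦ re - im * i`. -/
abbrev Cx (R : Type uR) [CommRing R] : Type uR := QuadraticAlgebra R (-1) 0

variable (R : Type uR) [CommRing R] [LinearOrder R] [IsStrictOrderedRing R]

/-- `z ≥ 0` in `C`: `z` lies in `R` and is nonnegative there. -/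
def IsNonneg {R : Type uR} [CommRing R] [LinearOrder R] (z : Cx R) : Prop :=
  0 ≤ z.re ∧ z.im = 0

variable {A : Type uA} [NonUnitalRing A] [StarRing A] [Module (Cx R) A]

/-- A positive linear functional: `ω (a* a) ≥ 0` for all `a`. -/
def IsPosFunctional (ω : A →ₗ[Cx R] Cx R) : Prop :=
  ∀ a : A, IsNonneg (ω (star a * a))

/-- A positive algebra element: all positive linear functionals are nonnegative on it. -/
def IsPosElem (a : A) : Prop :=
  ∀ ω : A →ₗ[Cx R] Cx R, IsPosFunctional R ω → IsNonneg (ω a)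

variable {R}

theorem IsNonneg.add {z z' : Cx R} (h : IsNonneg z) (h' : IsNonneg z') : IsNonneg (z + z') :=
  ⟨by simpa using add_nonneg h.1 h'.1, by simp [h.2, h'.2]⟩

theorem isPosElem_zero : IsPosElem R (0 : A) := fun ω _ => by
  simp [IsNonneg]

theorem IsPosElem.add {a a' : A} (h : IsPosElem R a) (h' : IsPosElem R a') :
    IsPosElem R (a + a') := fun ω hω => by
  rw [map_add]; exact (h ω hω).add (h' ω hω)

theorem IsPosElem.sum {ι : Type*} (s : Finset ι) (f : ι → A) (h : ∀ i ∈ s, IsPosElem R (f i)) :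
    IsPosElem R (∑ i ∈ s, f i) :=
  Finset.sum_induction f (IsPosElem R) (fun _ _ => IsPosElem.add) isPosElem_zero h

/-- A linear map that sends all `a* a` to positive elements preserves positive elements. -/
theorem IsPosElem.map {A' : Type uB} [NonUnitalRing A'] [StarRing A'] [Module (Cx R) A']
    (f : A →ₗ[Cx R] A') (hf : ∀ a, IsPosElem R (f (star a * a))) {a : A} (ha : IsPosElem R a) :
    IsPosElem R (f a) := fun ω hω =>
  ha (ω ∘ₗ f) fun b => hf b ω hω

end Positivity

/-! ### Bimodules with algebra-valued inner products -/

section Bimodule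

variable (R : Type uR) [CommRing R] [LinearOrder R] [IsStrictOrderedRing R]
variable (B : Type uB) [NonUnitalRing B] [StarRing B] [Module (Cx R) B]
  [IsScalarTower (Cx R) B B] [SMulCommClass (Cx R) B B] [StarModule (Cx R) B]
variable (A : Type uA) [NonUnitalRing A] [StarRing A] [Module (Cx R) A]
  [IsScalarTower (Cx R) A A] [SMulCommClass (Cx R) A A] [StarModule (Cx R) A]

/-- A `(B, A)`-bimodule (over `C`) with a completely positive, possibly degenerate, `A`-valued
inner product, on which `B` acts by adjointable operators. The left action is `lact b x = b · x`,
the right action is `ract a x = x · a`. -/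
structure SemiInnerBimodule where
  carrier : Type w
  [addCommGroup : AddCommGroup carrier]
  [module : Module (Cx R) carrier]
  lact : B →ₗ[Cx R] carrier →ₗ[Cx R] carrier
  lact_mul : ∀ b b' x, lact (b * b') x = lact b (lact b' x)
  ract : A →ₗ[Cx R] carrier →ₗ[Cx R] carrier
  ract_mul : ∀ a a' x, ract (a * a') x = ract a' (ract a x)
  lact_ract : ∀ b a x, lact b (ract a x) = ract a (lact b x)
  inner : carrier →ₗ⋆[Cx R] carrier →ₗ[Cx R] A
  inner_star : ∀ x y, inner x y = star (inner y x)
  inner_ract : ∀ x y a, inner x (ract a y) = inner x y * a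
  inner_lact : ∀ b x y, inner (lact b x) y = inner x (lact (star b) y)
  inner_cp : ∀ (n : ℕ) (x : Fin n → carrier),
    IsPosElem R (Matrix.of fun i j => inner (x i) (x j) : Matrix (Fin n) (Fin n) A)

attribute [instance] SemiInnerBimodule.addCommGroup SemiInnerBimodule.module

/-- A pre-Hilbert `(B, A)`-bimodule, that is, a `*`-representation of `B` on a pre-Hilbert
`A`-module: the `A`-valued inner product is completely positive and non-degenerate. -/
structure PreHilbertBimodule extends SemiInnerBimodule.{uR, uA, uB, w} R B A where
  inner_nondeg : ∀ y, (∀ x, inner x y = 0) → y = 0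

/-- A strong Morita equivalence bimodule. The left inner product `linner x y` has values in `B`
and is linear in the first argument. -/
structure EquivalenceBimodule extends PreHilbertBimodule.{uR, uA, uB, w} R B A where
  span_lact : Submodule.span (Cx R) {z | ∃ b x, lact b x = z} = ⊤
  span_ract : Submodule.span (Cx R) {z | ∃ a x, ract a x = z} = ⊤
  linner : carrier →ₗ[Cx R] carrier →ₗ⋆[Cx R] B
  linner_star : ∀ x y, linner x y = star (linner y x)
  linner_lact : ∀ b x y, linner (lact b x) y = b * linner x y
  linner_ract : ∀ a x y, linner (ract a x) y = linner x (ract (star a) y)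
  linner_cp : ∀ (n : ℕ) (x : Fin n → carrier),
    IsPosElem R (Matrix.of fun i j => linner (x i) (x j) : Matrix (Fin n) (Fin n) B)
  linner_nondeg : ∀ x, (∀ y, linner x y = 0) → x = 0
  linner_inner : ∀ x y z, lact (linner x y) z = ract (inner y z) x
  span_inner : Submodule.span (Cx R) {a | ∃ x y, inner x y = a} = ⊤
  span_linner : Submodule.span (Cx R) {b | ∃ x y, linner x y = b} = ⊤

end Bimodule

/-- Strong Morita equivalence: there is a strong Morita equivalence `(B, A)`-bimodule. -/
def StronglyMoritaEquivalent (R : Type uR) [CommRing R] [LinearOrder R] [IsStrictOrderedRing R]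
    (A : Type uA) [NonUnitalRing A] [StarRing A] [Module (Cx R) A]
    [IsScalarTower (Cx R) A A] [SMulCommClass (Cx R) A A] [StarModule (Cx R) A]
    (B : Type uA) [NonUnitalRing B] [StarRing B] [Module (Cx R) B]
    [IsScalarTower (Cx R) B B] [SMulCommClass (Cx R) B B] [StarModule (Cx R) B] : Prop :=
  Nonempty (EquivalenceBimodule.{uR, uA, uA, uA} R B A)

/-- The `*`-algebras over `C` (not necessarily unital) that are nondegenerate (`a A = 0` or
`A a = 0` only for `a = 0`) and idempotent (the products `a b` span `A`). -/
structure NondegIdemStarAlgebra (R : Type uR) [CommRing R] where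
  carrier : Type uA
  [nonUnitalRing : NonUnitalRing carrier]
  [starRing : StarRing carrier]
  [module : Module (Cx R) carrier]
  [isScalarTower : IsScalarTower (Cx R) carrier carrier]
  [smulCommClass : SMulCommClass (Cx R) carrier carrier]
  [starModule : StarModule (Cx R) carrier]
  nondegenerate : ∀ a : carrier, ((∀ b, a * b = 0) ∨ (∀ b, b * a = 0)) → a = 0
  idempotent : Submodule.span (Cx R) {c : carrier | ∃ a b, a * b = c} = ⊤

attribute [instance] NondegIdemStarAlgebra.nonUnitalRing NondegIdemStarAlgebra.starRing
  NondegIdemStarAlgebra.module NondegIdemStarAlgebra.isScalarTower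
  NondegIdemStarAlgebra.smulCommClass NondegIdemStarAlgebra.starModule

/-! ### The quotient by the degeneracy space -/

namespace SemiInnerBimodule

section Quotient

variable {R : Type uR} [CommRing R] [LinearOrder R] [IsStrictOrderedRing R]
variable {B : Type uB} [NonUnitalRing B] [StarRing B] [Module (Cx R) B]
  [IsScalarTower (Cx R) B B] [SMulCommClass (Cx R) B B] [StarModule (Cx R) B]
variable {A : Type uA} [NonUnitalRing A] [StarRing A] [Module (Cx R) A]
  [IsScalarTower (Cx R) A A] [SMulCommClass (Cx R) A A] [StarModule (Cx R) A]
variable (E : SemiInnerBimodule.{uR, uA, uB, w} R B A)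

/-- The degeneracy space `E^⊥`. -/
def perp : Submodule (Cx R) E.carrier where
  carrier := {y | ∀ x, E.inner x y = 0}
  add_mem' := fun ha hb x => by rw [map_add, ha x, hb x, add_zero]
  zero_mem' := fun x => map_zero _
  smul_mem' := fun c y hy x => by rw [map_smul, hy x, smul_zero]

theorem inner_eq_zero_of_mem_perp {x : E.carrier} (hx : x ∈ E.perp) (y : E.carrier) :
    E.inner x y = 0 := by
  rw [E.inner_star, hx y, star_zero]

theorem lact_mem_perp (b : B) {y : E.carrier} (hy : y ∈ E.perp) : E.lact b y ∈ E.perp := by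
  intro x
  have h := E.inner_lact (star b) x y
  rw [star_star] at h
  rw [← h]; exact hy _

theorem ract_mem_perp (a : A) {y : E.carrier} (hy : y ∈ E.perp) : E.ract a y ∈ E.perp := by
  intro x
  rw [E.inner_ract, hy x, zero_mul]

/-- The pre-Hilbert bimodule `E / E^⊥`. -/
def quotPerp : PreHilbertBimodule.{uR, uA, uB, w} R B A where
  carrier := E.carrier ⧸ E.perp
  lact :=
    { toFun := fun b => E.perp.mapQ E.perp (E.lact b) fun _ hy => E.lact_mem_perp b hy
      map_add' := fun b b' => by ext x; simp
      map_smul' := fun c b => by ext x; simp }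
  lact_mul := fun b b' x => by
    induction x using Submodule.Quotient.induction_on with
    | H x => simp [E.lact_mul]
  ract :=
    { toFun := fun a => E.perp.mapQ E.perp (E.ract a) fun _ hy => E.ract_mem_perp a hy
      map_add' := fun b b' => by ext x; simp
      map_smul' := fun c b => by ext x; simp }
  ract_mul := fun a a' x => by
    induction x using Submodule.Quotient.induction_on with
    | H x => simp [E.ract_mul]
  lact_ract := fun b a x => by
    induction x using Submodule.Quotient.induction_on with
    | H x => simp [E.lact_ract]
  inner := E.perp.liftQ
    { toFun := fun x => E.perp.liftQ (E.inner x) fun _ hy => hy x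
      map_add' := fun x x' => by
        ext y
        change E.inner (x + x') y = E.inner x y + E.inner x' y
        simp
      map_smul' := fun c x => by
        ext y
        change E.inner (c • x) y = starRingEnd (Cx R) c • E.inner x y
        simp }
    fun x hx => by
      rw [LinearMap.mem_ker]
      ext y
      exact E.inner_eq_zero_of_mem_perp hx y
  inner_star := fun x y => by
    induction x using Submodule.Quotient.induction_on with
    | H x =>
      induction y using Submodule.Quotient.induction_on with
      | H y => exact E.inner_star x y
  inner_ract := fun x y a => by
    induction x using Submodule.Quotient.induction_on with
    | H x =>
      induction y using Submodule.Quotient.induction_on with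
      | H y => exact E.inner_ract x y a
  inner_lact := fun b x y => by
    induction x using Submodule.Quotient.induction_on with
    | H x =>
      induction y using Submodule.Quotient.induction_on with
      | H y => exact E.inner_lact b x y
  inner_cp := fun n x => by
    choose x' hx' using fun i => Submodule.Quotient.mk_surjective E.perp (x i)
    obtain rfl : (fun i => Submodule.Quotient.mk (x' i)) = x := funext hx'
    exact E.inner_cp n x'
  inner_nondeg := fun y hy => by
    induction y using Submodule.Quotient.induction_on with
    | H y =>
      rw [Submodule.Quotient.mk_eq_zero]
      exact fun x => hy (Submodule.Quotient.mk x)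

end Quotient

/-! ### The balanced tensor product `E ⊗_A H` -/

section Tensor

variable {R : Type uR} [CommRing R] [LinearOrder R] [IsStrictOrderedRing R]
variable {B : Type uB} [NonUnitalRing B] [StarRing B] [Module (Cx R) B]
  [IsScalarTower (Cx R) B B] [SMulCommClass (Cx R) B B] [StarModule (Cx R) B]
variable {A : Type uA} [NonUnitalRing A] [StarRing A] [Module (Cx R) A]
  [IsScalarTower (Cx R) A A] [SMulCommClass (Cx R) A A] [StarModule (Cx R) A]
variable {D : Type uD} [NonUnitalRing D] [StarRing D] [Module (Cx R) D]
  [IsScalarTower (Cx R) D D] [SMulCommClass (Cx R) D D] [StarModule (Cx R) D]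
variable (E : SemiInnerBimodule.{uR, uA, uB, w} R B A)
  (H : SemiInnerBimodule.{uR, uD, uA, w} R A D)

/-- The submodule of `E ⊗_C H` spanned by all `(x · a) ⊗ h - x ⊗ (a · h)`. -/
def balanced : Submodule (Cx R) (E.carrier ⊗[Cx R] H.carrier) :=
  Submodule.span (Cx R) {t | ∃ a x h, t = E.ract a x ⊗ₜ[Cx R] h - x ⊗ₜ[Cx R] H.lact a h}

/-- The algebraic tensor product `E ⊗_A H` over the (possibly non-unital) algebra `A`. -/
abbrev BalTensor : Type w := (E.carrier ⊗[Cx R] H.carrier) ⧸ E.balanced H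

/-- The class of `x ⊗ h` in `E ⊗_A H`. -/
def btmul (x : E.carrier) (h : H.carrier) : E.BalTensor H :=
  Submodule.Quotient.mk (x ⊗ₜ[Cx R] h)

variable {E H}

theorem balTensor_induction {p : E.BalTensor H → Prop} (t : E.BalTensor H)
    (zero : p 0) (tmul : ∀ x h, p (E.btmul H x h)) (add : ∀ s t, p s → p t → p (s + t)) : p t := by
  induction t using Submodule.Quotient.induction_on with
  | H t =>
    induction t using TensorProduct.induction_on with
    | zero => exact zero
    | tmul x h => exact tmul x h
    | add s t hs ht => exact add _ _ hs ht

theorem balTensor_hom_ext {M : Type*} [AddCommGroup M] [Module (Cx R) M]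
    {σ : Cx R →+* Cx R} {f g : E.BalTensor H →ₛₗ[σ] M}
    (hfg : ∀ x h, f (E.btmul H x h) = g (E.btmul H x h)) : f = g := by
  refine LinearMap.ext fun t => ?_
  induction t using balTensor_induction with
  | zero => simp
  | tmul x h => exact hfg x h
  | add s t hs ht => rw [map_add, map_add, hs, ht]

theorem btmul_ract (a : A) (x : E.carrier) (h : H.carrier) :
    E.btmul H (E.ract a x) h = E.btmul H x (H.lact a h) :=
  (Submodule.Quotient.eq _).2 (Submodule.subset_span ⟨a, x, h, rfl⟩)

/-- The map `f ⊗ g` on balanced tensor products, for `A`-linear `f` and `g`. -/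
def balMap {E' : SemiInnerBimodule.{uR, uA, uB, w} R B A}
    {H' : SemiInnerBimodule.{uR, uD, uA, w} R A D}
    (f : E.carrier →ₗ[Cx R] E'.carrier) (g : H.carrier →ₗ[Cx R] H'.carrier)
    (hf : ∀ a x, f (E.ract a x) = E'.ract a (f x))
    (hg : ∀ a h, g (H.lact a h) = H'.lact a (g h)) :
    E.BalTensor H →ₗ[Cx R] E'.BalTensor H' :=
  (E.balanced H).mapQ (E'.balanced H') (TensorProduct.map f g) <| by
    refine Submodule.span_le.2 ?_
    rintro _ ⟨a, x, h, rfl⟩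
    refine Submodule.subset_span ⟨a, f x, g h, ?_⟩
    simp [hf, hg]

theorem balMap_btmul {E' : SemiInnerBimodule.{uR, uA, uB, w} R B A}
    {H' : SemiInnerBimodule.{uR, uD, uA, w} R A D}
    (f : E.carrier →ₗ[Cx R] E'.carrier) (g : H.carrier →ₗ[Cx R] H'.carrier)
    (hf : ∀ a x, f (E.ract a x) = E'.ract a (f x))
    (hg : ∀ a h, g (H.lact a h) = H'.lact a (g h)) (x : E.carrier) (h : H.carrier) :
    balMap f g hf hg (E.btmul H x h) = E'.btmul H' (f x) (g h) := rfl

variable (E H)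

/-- The action of `B` on `E ⊗_A H`: `b · (x ⊗ h) = (b · x) ⊗ h`. -/
def tensorLact : B →ₗ[Cx R] E.BalTensor H →ₗ[Cx R] E.BalTensor H where
  toFun b := balMap (E.lact b) LinearMap.id (fun a x => E.lact_ract b a x) (fun _ _ => rfl)
  map_add' b b' := balTensor_hom_ext fun x h => by
    change E.btmul H (E.lact (b + b') x) h = E.btmul H (E.lact b x) h + E.btmul H (E.lact b' x) h
    simp [btmul, TensorProduct.add_tmul]
  map_smul' c b := balTensor_hom_ext fun x h => by
    change E.btmul H (E.lact (c • b) x) h = c • E.btmul H (E.lact b x) h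
    simp [btmul, ← TensorProduct.smul_tmul']

/-- The action of `D` on `E ⊗_A H`: `(x ⊗ h) · d = x ⊗ (h · d)`. -/
def tensorRact : D →ₗ[Cx R] E.BalTensor H →ₗ[Cx R] E.BalTensor H where
  toFun d := balMap LinearMap.id (H.ract d) (fun _ _ => rfl) (fun a x => (H.lact_ract a d x).symm)
  map_add' d d' := balTensor_hom_ext fun x h => by
    change E.btmul H x (H.ract (d + d') h) = E.btmul H x (H.ract d h) + E.btmul H x (H.ract d' h)
    simp [btmul, TensorProduct.tmul_add]
  map_smul' c d := balTensor_hom_ext fun x h => by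
    change E.btmul H x (H.ract (c • d) h) = c • E.btmul H x (H.ract d h)
    simp [btmul]

/-- The linear functional `y ⊗ k ↦ ⟨h, ⟨x, y⟩ · k⟩` on `E ⊗_A H`. -/
def tensorInnerAux (x : E.carrier) (h : H.carrier) : E.BalTensor H →ₗ[Cx R] D :=
  (E.balanced H).liftQ
    (TensorProduct.lift (LinearMap.mk₂ (Cx R) (fun y k => H.inner h (H.lact (E.inner x y) k))
      (by simp) (by simp) (by simp) (by simp))) <| by
    refine Submodule.span_le.2 ?_
    rintro _ ⟨a, y, k, rfl⟩
    simp [E.inner_ract, H.lact_mul]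

theorem tensorInnerAux_btmul (x : E.carrier) (h : H.carrier) (y : E.carrier) (k : H.carrier) :
    E.tensorInnerAux H x h (E.btmul H y k) = H.inner h (H.lact (E.inner x y) k) := rfl

/-- The `D`-valued inner product on `E ⊗_A H` determined by
`⟨x ⊗ h, y ⊗ k⟩ = ⟨h, ⟨x, y⟩ · k⟩`. -/
def tensorInner : E.BalTensor H →ₗ⋆[Cx R] E.BalTensor H →ₗ[Cx R] D :=
  (E.balanced H).liftQ
    (TensorProduct.lift (LinearMap.mk₂'ₛₗ (starRingEnd (Cx R)) (starRingEnd (Cx R))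
      (fun x h => E.tensorInnerAux H x h)
      (fun x x' h => balTensor_hom_ext fun y k => by simp [tensorInnerAux_btmul])
      (fun c x h => balTensor_hom_ext fun y k => by simp [tensorInnerAux_btmul])
      (fun x h h' => balTensor_hom_ext fun y k => by simp [tensorInnerAux_btmul])
      (fun c x h => balTensor_hom_ext fun y k => by simp [tensorInnerAux_btmul]))) <| by
    refine Submodule.span_le.2 ?_
    rintro _ ⟨a, x, h, rfl⟩
    rw [SetLike.mem_coe, LinearMap.mem_ker, map_sub, sub_eq_zero]
    refine balTensor_hom_ext fun y k => ?_
    have h1 : E.inner (E.ract a x) y = star a * E.inner x y := by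
      rw [E.inner_star, E.inner_ract, star_mul, ← E.inner_star]
    simp [tensorInnerAux_btmul, h1, H.lact_mul, H.inner_lact]

theorem tensorInner_btmul (x : E.carrier) (h : H.carrier) (y : E.carrier) (k : H.carrier) :
    E.tensorInner H (E.btmul H x h) (E.btmul H y k) = H.inner h (H.lact (E.inner x y) k) := rfl

theorem tensorInner_star (s t : E.BalTensor H) :
    E.tensorInner H s t = star (E.tensorInner H t s) := by
  induction s using balTensor_induction with
  | zero => simp
  | add s s' hs hs' => simp [hs, hs']
  | tmul x h =>
    induction t using balTensor_induction with
    | zero => simp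
    | add t t' ht ht' => simp [ht, ht']
    | tmul y k =>
      rw [tensorInner_btmul, tensorInner_btmul, ← H.inner_star, H.inner_lact, ← E.inner_star]

theorem exists_sum_btmul (t : E.BalTensor H) :
    ∃ (n : ℕ) (x : Fin n → E.carrier) (h : Fin n → H.carrier),
      t = ∑ k, E.btmul H (x k) (h k) := by
  induction t using balTensor_induction with
  | zero => exact ⟨0, Fin.elim0, Fin.elim0, by simp⟩
  | tmul x h => exact ⟨1, fun _ => x, fun _ => h, by simp⟩
  | add s t hs ht =>
    obtain ⟨m, x, h, rfl⟩ := hs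
    obtain ⟨n, y, k, rfl⟩ := ht
    refine ⟨m + n, Fin.append x y, Fin.append h k, ?_⟩
    simp [Fin.sum_univ_add]

/-- The inner product on `E ⊗_A H` is completely positive. -/
theorem tensorInner_cp (n : ℕ) (u : Fin n → E.BalTensor H) :
    IsPosElem R (Matrix.of fun i j => E.tensorInner H (u i) (u j) :
      Matrix (Fin n) (Fin n) D) := by
  choose m x h hu using fun i => E.exists_sum_btmul H (u i)
  obtain rfl : (fun i => ∑ k, E.btmul H (x i k) (h i k)) = u := (funext hu).symm
  let e : Fin (∑ i, m i) ≃ Σ i, Fin (m i) := finSigmaFinEquiv.symm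
  let f : Matrix (Fin (∑ i, m i)) (Fin (∑ i, m i)) A →ₗ[Cx R] Matrix (Fin n) (Fin n) D :=
    { toFun := fun M => Matrix.of fun i j => ∑ k, ∑ l,
        H.inner (h i k) (H.lact (M (e.symm ⟨i, k⟩) (e.symm ⟨j, l⟩)) (h j l))
      map_add' := fun M M' => by ext i j; simp [Finset.sum_add_distrib]
      map_smul' := fun c M => by ext i j; simp [Finset.smul_sum] }
  have hpos : ∀ M, IsPosElem R (f (star M * M)) := fun M => by
    have : f (star M * M) = ∑ r, Matrix.of fun i j =>
        H.inner (∑ k, H.lact (M r (e.symm ⟨i, k⟩)) (h i k))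
          (∑ l, H.lact (M r (e.symm ⟨j, l⟩)) (h j l)) := by
      ext i j
      simp only [f, LinearMap.coe_mk, AddHom.coe_mk, Matrix.of_apply, Matrix.mul_apply,
        Matrix.star_apply, Matrix.sum_apply, map_sum, LinearMap.sum_apply, H.lact_mul,
        H.inner_lact]
      rw [Finset.sum_comm' (t' := Finset.univ) (s' := fun _ => Finset.univ) (by simp)]
      simp only [Finset.sum_comm (t := (Finset.univ : Finset (Fin (∑ i, m i))))]
    rw [this]
    exact IsPosElem.sum _ _ fun r _ => H.inner_cp n _
  have key := (E.inner_cp _ fun p => x (e p).1 (e p).2).map f hpos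
  convert key using 1
  ext i j
  have hx : ∀ i k, x (e (e.symm ⟨i, k⟩)).1 (e (e.symm ⟨i, k⟩)).2 = x i k := fun i k => by
    rw [Equiv.apply_symm_apply]
  simp only [f, LinearMap.coe_mk, AddHom.coe_mk, Matrix.of_apply, hx, map_sum,
    LinearMap.sum_apply, tensorInner_btmul]
  exact Finset.sum_comm

/-- `E ⊗_A H` as a `(B, D)`-bimodule with its completely positive inner product. -/
def tensor : SemiInnerBimodule.{uR, uD, uB, w} R B D where
  carrier := E.BalTensor H
  lact := E.tensorLact H
  lact_mul := fun b b' t => by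
    induction t using balTensor_induction with
    | zero => simp
    | add s t hs ht => simp [hs, ht]
    | tmul x h => simp [tensorLact, balMap_btmul, E.lact_mul]
  ract := E.tensorRact H
  ract_mul := fun b b' t => by
    induction t using balTensor_induction with
    | zero => simp
    | add s t hs ht => simp [hs, ht]
    | tmul x h => simp [tensorRact, balMap_btmul, H.ract_mul]
  lact_ract := fun b d t => by
    induction t using balTensor_induction with
    | zero => simp
    | add s t hs ht => simp [hs, ht]
    | tmul x h => simp [tensorLact, tensorRact, balMap_btmul]
  inner := E.tensorInner H
  inner_star := E.tensorInner_star H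
  inner_ract := fun s t d => by
    induction s using balTensor_induction with
    | zero => simp
    | add s s' hs hs' => simp [hs, hs', add_mul]
    | tmul x h =>
      induction t using balTensor_induction with
      | zero => simp
      | add t t' ht ht' => simp [ht, ht', add_mul]
      | tmul y k =>
        simp [tensorRact, balMap_btmul, tensorInner_btmul, H.lact_ract, H.inner_ract]
  inner_lact := fun b s t => by
    induction s using balTensor_induction with
    | zero => simp
    | add s s' hs hs' => simp [hs, hs']
    | tmul x h =>
      induction t using balTensor_induction with
      | zero => simp
      | add t t' ht ht' => simp [ht, ht']
      | tmul y k =>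
        simp [tensorLact, balMap_btmul, tensorInner_btmul, E.inner_lact]
  inner_cp := E.tensorInner_cp H

end Tensor

end SemiInnerBimodule

/-! ### Representation categories and Rieffel induction -/

section Rieffel

variable {R : Type uR} [CommRing R] [LinearOrder R] [IsStrictOrderedRing R]
variable {B : Type uB} [NonUnitalRing B] [StarRing B] [Module (Cx R) B]
  [IsScalarTower (Cx R) B B] [SMulCommClass (Cx R) B B] [StarModule (Cx R) B]
variable {A : Type uA} [NonUnitalRing A] [StarRing A] [Module (Cx R) A]
  [IsScalarTower (Cx R) A A] [SMulCommClass (Cx R) A A] [StarModule (Cx R) A]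
variable {D : Type uD} [NonUnitalRing D] [StarRing D] [Module (Cx R) D]
  [IsScalarTower (Cx R) D D] [SMulCommClass (Cx R) D D] [StarModule (Cx R) D]

/-- Adjointable intertwiners. -/
@[ext]
structure PreHilbertBimodule.Hom (H K : PreHilbertBimodule.{uR, uD, uA, w} R A D) where
  toLin : H.carrier →ₗ[Cx R] K.carrier
  adjointable : ∃ S : K.carrier →ₗ[Cx R] H.carrier,
    ∀ x y, K.inner (toLin x) y = H.inner x (S y)
  intertwines : ∀ a x, toLin (H.lact a x) = K.lact a (toLin x)

/-- The category of `*`-representations of `A` on pre-Hilbert `D`-modules, with adjointable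
intertwiners as morphisms. -/
instance : Category.{w} (PreHilbertBimodule.{uR, uD, uA, w} R A D) where
  Hom H K := PreHilbertBimodule.Hom H K
  id H := ⟨LinearMap.id, ⟨LinearMap.id, fun _ _ => rfl⟩, fun _ _ => rfl⟩
  comp f g := ⟨g.toLin ∘ₗ f.toLin, by
    obtain ⟨S, hS⟩ := f.adjointable
    obtain ⟨T, hT⟩ := g.adjointable
    exact ⟨S ∘ₗ T, fun x y => by simp [hS, hT]⟩,
    fun a x => by simp [f.intertwines, g.intertwines]⟩

/-- The bimodule `E ⊗̂_A H = (E ⊗_A H) / (E ⊗_A H)^⊥`. -/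
def PreHilbertBimodule.hatTensor (E : PreHilbertBimodule.{uR, uA, uB, w} R B A)
    (H : PreHilbertBimodule.{uR, uD, uA, w} R A D) : PreHilbertBimodule.{uR, uD, uB, w} R B D :=
  (E.toSemiInnerBimodule.tensor H.toSemiInnerBimodule).quotPerp

open SemiInnerBimodule in
theorem tensor_adjoint (E : SemiInnerBimodule.{uR, uA, uB, w} R B A)
    {H K : SemiInnerBimodule.{uR, uD, uA, w} R A D}
    (T : H.carrier →ₗ[Cx R] K.carrier) (S : K.carrier →ₗ[Cx R] H.carrier)
    (hT : ∀ a x, T (H.lact a x) = K.lact a (T x)) (hS : ∀ a x, S (K.lact a x) = H.lact a (S x))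
    (h : ∀ x y, K.inner (T x) y = H.inner x (S y)) (s : E.BalTensor H) (t : E.BalTensor K) :
    E.tensorInner K (balMap LinearMap.id T (fun _ _ => rfl) hT s) t =
      E.tensorInner H s (balMap LinearMap.id S (fun _ _ => rfl) hS t) := by
  induction s using balTensor_induction with
  | zero => simp
  | add s s' hs hs' => simp [hs, hs']
  | tmul x k =>
    induction t using balTensor_induction with
    | zero => simp
    | add t t' ht ht' => simp [ht, ht']
    | tmul y l => simp [balMap_btmul, tensorInner_btmul, h, hS]

open SemiInnerBimodule in
theorem balMap_tensorLact (E : SemiInnerBimodule.{uR, uA, uB, w} R B A)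
    {H K : SemiInnerBimodule.{uR, uD, uA, w} R A D} (T : H.carrier →ₗ[Cx R] K.carrier)
    (hT : ∀ a x, T (H.lact a x) = K.lact a (T x)) (b : B) (t : E.BalTensor H) :
    balMap LinearMap.id T (fun _ _ => rfl) hT (E.tensorLact H b t) =
      E.tensorLact K b (balMap LinearMap.id T (fun _ _ => rfl) hT t) := by
  induction t using balTensor_induction with
  | zero => simp
  | add s t hs ht => simp [hs, ht]
  | tmul x h => rfl

open SemiInnerBimodule in
theorem balMap_id (E : SemiInnerBimodule.{uR, uA, uB, w} R B A)
    {H : SemiInnerBimodule.{uR, uD, uA, w} R A D}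
    (h : ∀ a x, LinearMap.id (R := Cx R) (H.lact a x) = H.lact a (LinearMap.id (R := Cx R) x))
    (t : E.BalTensor H) :
    balMap (E := E) (E' := E) LinearMap.id LinearMap.id (fun _ _ => rfl) h t = t := by
  induction t using balTensor_induction with
  | zero => simp
  | add s t hs ht => simp [hs, ht]
  | tmul x h => rfl

open SemiInnerBimodule in
theorem balMap_comp (E : SemiInnerBimodule.{uR, uA, uB, w} R B A)
    {H K L : SemiInnerBimodule.{uR, uD, uA, w} R A D} (T : H.carrier →ₗ[Cx R] K.carrier)
    (S : K.carrier →ₗ[Cx R] L.carrier)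
    (hT : ∀ a x, T (H.lact a x) = K.lact a (T x)) (hS : ∀ a x, S (K.lact a x) = L.lact a (S x))
    (hST : ∀ a x, (S ∘ₗ T) (H.lact a x) = L.lact a ((S ∘ₗ T) x)) (t : E.BalTensor H) :
    balMap (E := E) (E' := E) LinearMap.id (S ∘ₗ T) (fun _ _ => rfl) hST t =
      balMap (E := E) (E' := E) LinearMap.id S (fun _ _ => rfl) hS
        (balMap (E := E) LinearMap.id T (fun _ _ => rfl) hT t) := by
  induction t using balTensor_induction with
  | zero => simp
  | add s t hs ht => simp [hs, ht]
  | tmul x h => rfl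

/-- The adjoint of an adjointable intertwiner intertwines. -/
theorem adjoint_intertwines {H K : PreHilbertBimodule.{uR, uD, uA, w} R A D}
    (T : PreHilbertBimodule.Hom H K) (S : K.carrier →ₗ[Cx R] H.carrier)
    (h : ∀ x y, K.inner (T.toLin x) y = H.inner x (S y)) (a : A) (y : K.carrier) :
    S (K.lact a y) = H.lact a (S y) := by
  rw [← sub_eq_zero]
  refine H.inner_nondeg _ fun x => ?_
  have h1 := H.inner_lact (star a) x (S y)
  have h2 := K.inner_lact (star a) (T.toLin x) y
  rw [star_star] at h1 h2
  rw [map_sub, ← h, ← h1, ← h, T.intertwines, ← h2, sub_self]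

open SemiInnerBimodule in
/-- The morphism `id ⊗̂ T`. -/
def PreHilbertBimodule.hatTensorMap (E : PreHilbertBimodule.{uR, uA, uB, w} R B A)
    {H K : PreHilbertBimodule.{uR, uD, uA, w} R A D} (T : PreHilbertBimodule.Hom H K) :
    PreHilbertBimodule.Hom (E.hatTensor H) (E.hatTensor K) where
  toLin := Submodule.mapQ
    (E.toSemiInnerBimodule.tensor H.toSemiInnerBimodule).perp
    (E.toSemiInnerBimodule.tensor K.toSemiInnerBimodule).perp
    (balMap LinearMap.id T.toLin (fun _ _ => rfl) T.intertwines) <| by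
      obtain ⟨S, hS⟩ := T.adjointable
      intro t ht s
      refine (tensorInner_star _ _ _ _).trans ?_
      erw [tensor_adjoint E.toSemiInnerBimodule T.toLin S T.intertwines
        (adjoint_intertwines T S hS) hS, ← tensorInner_star]
      exact ht _
  adjointable := by
    obtain ⟨S, hS⟩ := T.adjointable
    have hSi := adjoint_intertwines T S hS
    have key := tensor_adjoint E.toSemiInnerBimodule T.toLin S T.intertwines hSi hS
    refine ⟨Submodule.mapQ
      (E.toSemiInnerBimodule.tensor K.toSemiInnerBimodule).perp
      (E.toSemiInnerBimodule.tensor H.toSemiInnerBimodule).perp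
      (balMap LinearMap.id S (fun _ _ => rfl) hSi) fun t ht s => (key s t).symm.trans (ht _), ?_⟩
    intro x y
    induction x using Submodule.Quotient.induction_on with
    | H x =>
      induction y using Submodule.Quotient.induction_on with
      | H y => exact key x y
  intertwines := fun b x => by
    induction x using Submodule.Quotient.induction_on with
    | H x =>
      exact congrArg (Submodule.Quotient.mk (p := (E.toSemiInnerBimodule.tensor
        K.toSemiInnerBimodule).perp)) (balMap_tensorLact E.toSemiInnerBimodule T.toLin
          T.intertwines b x)

/-- Rieffel induction `E ⊗̂_A -` from `*`-representations of `A` to `*`-representations of `B`,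
on pre-Hilbert `D`-modules. -/
def rieffelInduction (E : PreHilbertBimodule.{uR, uA, uB, w} R B A) :
    PreHilbertBimodule.{uR, uD, uA, w} R A D ⥤ PreHilbertBimodule.{uR, uD, uB, w} R B D where
  obj H := E.hatTensor H
  map T := E.hatTensorMap T
  map_id H := by
    refine PreHilbertBimodule.Hom.ext (LinearMap.ext fun x => ?_)
    induction x using Submodule.Quotient.induction_on with
    | H x =>
      exact congrArg (Submodule.Quotient.mk (p := (E.toSemiInnerBimodule.tensor
        H.toSemiInnerBimodule).perp)) (balMap_id E.toSemiInnerBimodule _ x)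
  map_comp {H K L} f g := by
    refine PreHilbertBimodule.Hom.ext (LinearMap.ext fun x => ?_)
    induction x using Submodule.Quotient.induction_on with
    | H x =>
      exact congrArg (Submodule.Quotient.mk (p := (E.toSemiInnerBimodule.tensor
        L.toSemiInnerBimodule).perp)) (balMap_comp E.toSemiInnerBimodule f.toLin g.toLin
          f.intertwines g.intertwines (f ≫ g).intertwines x)

variable (R A D) in
/-- The condition `A · H = H`. -/
def IsStronglyNondegenerate : ObjectProperty (PreHilbertBimodule.{uR, uD, uA, w} R A D) :=
  fun H => Submodule.span (Cx R) {z | ∃ a x, H.lact a x = z} = ⊤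

variable (R A D) in
/-- `Rep_D(A)`: the full subcategory of `*`-representations of `A` on pre-Hilbert `D`-modules `H`
with `A · H = H`. -/
abbrev Rep : Type (max uR uA uD (w + 1)) :=
  (IsStronglyNondegenerate.{uR, uA, uD, w} R A D).FullSubcategory

theorem hatTensor_stronglyNondegenerate (E : PreHilbertBimodule.{uR, uA, uB, w} R B A)
    (hE : Submodule.span (Cx R) {z | ∃ b x, E.lact b x = z} = ⊤)
    (H : PreHilbertBimodule.{uR, uD, uA, w} R A D) :
    IsStronglyNondegenerate R B D (E.hatTensor H) := by
  refine Submodule.eq_top_iff'.2 fun t => ?_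
  induction t using Submodule.Quotient.induction_on with
  | H t =>
    induction t using SemiInnerBimodule.balTensor_induction with
    | zero => exact Submodule.zero_mem _
    | add s t hs ht => exact Submodule.add_mem _ hs ht
    | tmul x h =>
      let q : E.carrier →ₗ[Cx R] (E.hatTensor H).carrier :=
        (E.toSemiInnerBimodule.tensor H.toSemiInnerBimodule).perp.mkQ ∘ₗ
          (E.toSemiInnerBimodule.balanced H.toSemiInnerBimodule).mkQ ∘ₗ
            (TensorProduct.mk (Cx R) E.carrier H.carrier).flip h
      have hx : x ∈ Submodule.span (Cx R) {z | ∃ b x, E.lact b x = z} := hE ▸ Submodule.mem_top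
      have := Submodule.mem_map_of_mem (f := q) hx
      rw [Submodule.map_span] at this
      refine Submodule.span_mono ?_ this
      rintro _ ⟨_, ⟨b, y, rfl⟩, rfl⟩
      exact ⟨b, q y, rfl⟩

/-- Rieffel induction `E ⊗̂_A - : Rep_D(A) ⥤ Rep_D(B)` for a strong Morita equivalence
bimodule `E`. -/
def rieffelRep (E : EquivalenceBimodule.{uR, uA, uB, w} R B A) :
    Rep.{uR, uA, uD, w} R A D ⥤ Rep.{uR, uB, uD, w} R B D :=
  (IsStronglyNondegenerate R B D).lift
    ((IsStronglyNondegenerate R A D).ι ⋙ rieffelInduction E.toPreHilbertBimodule)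
    fun H => hatTensor_stronglyNondegenerate E.toPreHilbertBimodule E.span_lact H.obj

end Rieffel

/-! ### Equivalence bimodules over unital algebras as modules in the usual sense -/

namespace EquivalenceBimodule

section Unital

variable {R : Type uR} [CommRing R] [LinearOrder R] [IsStrictOrderedRing R]
variable {B : Type uB} [Ring B] [StarRing B] [Algebra (Cx R) B] [StarModule (Cx R) B]
variable {A : Type uA} [Ring A] [StarRing A] [Algebra (Cx R) A] [StarModule (Cx R) A]
variable (E : EquivalenceBimodule.{uR, uA, uB, w} R B A)

theorem lact_one (x : E.carrier) : E.lact 1 x = x := by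
  have : E.lact 1 = LinearMap.id := by
    refine LinearMap.ext_on E.span_lact ?_
    rintro _ ⟨b, y, rfl⟩
    rw [← E.lact_mul, one_mul]; rfl
  rw [this]; rfl

theorem ract_one (x : E.carrier) : E.ract 1 x = x := by
  have : E.ract 1 = LinearMap.id := by
    refine LinearMap.ext_on E.span_ract ?_
    rintro _ ⟨b, y, rfl⟩
    rw [← E.ract_mul, mul_one]; rfl
  rw [this]; rfl

/-- `E` as a left `B`-module. -/
abbrev leftModule : Module B E.carrier where
  smul b x := E.lact b x
  one_smul := E.lact_one
  mul_smul b b' x := E.lact_mul b b' x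
  smul_zero b := map_zero (E.lact b)
  smul_add b := map_add (E.lact b)
  add_smul b b' x := by
    change E.lact (b + b') x = E.lact b x + E.lact b' x
    simp
  zero_smul x := by
    change E.lact 0 x = 0
    simp

/-- `E` as a right `A`-module, that is, a module over the opposite ring of `A`. -/
abbrev rightModule : Module Aᵐᵒᵖ E.carrier where
  smul a x := E.ract a.unop x
  one_smul := E.ract_one
  mul_smul a a' x := E.ract_mul a'.unop a.unop x
  smul_zero a := map_zero (E.ract a.unop)
  smul_add a := map_add (E.ract a.unop)
  add_smul a a' x := by
    change E.ract (a.unop + a'.unop) x = E.ract a.unop x + E.ract a'.unop x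
    simp
  zero_smul x := by
    change E.ract 0 x = 0
    simp

end Unital

end EquivalenceBimodule

end

end StarMorita

/-! The theorem rests on the compatibility `_B⟨x,y⟩ z = x ⟨y,z⟩_A`, on the fullness of both inner
products (their values span the algebras), and on the conjugate bimodule `Ē`, in which the two sides
trade places.

Equivalence relation. Reflexivity is witnessed by `A` itself with `a* b` and `a b*`, symmetry by
`Ē`. Transitivity uses `F ⊗_B E`: its right inner product is already known to be completely
positive, and its left one is the right inner product of `Ē ⊗_B F̄`, pulled back along the
antilinear flip. Compatibility survives on the algebraic tensor product (`tensorLinner_inner`);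
together with fullness and nondegeneracy of the outer algebras it forces the two degeneracy spaces
to coincide, so a single quotient makes both inner products non-degenerate.

Rieffel induction. The map `x̄ ⊗ (y ⊗ h) ↦ ⟨x,y⟩ h` from `Ē ⊗_B (E ⊗̂_A H)` to `H` preserves inner
products by compatibility and is onto because `⟨E,E⟩` spans `A` and `A H = H`. A surjective isometry
onto a non-degenerate module has exactly the degeneracy space as kernel, so it induces a natural
isomorphism. Hence induction along `Ē` is a left inverse of induction along `E`; applied to `Ē`, the
same statement yields the other inverse.

Unital algebras. Writing `1 = Σ _B⟨ξ_i,η_i⟩` and applying both sides to `x` gives `x = Σ ξ_i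
⟨η_i,x⟩`, a finite dual basis; the other side is analogous. For module categories the functor is `M
↦ Hom_A(Ē, M)`. The natural map `m ↦ (x ↦ (y ↦ ⟨y,x⟩ m))` into the double Hom is inverted by `Φ ↦ Σ
Φ(η_i)(ξ_i)` for any expansion `1 = Σ ⟨ξ_i,η_i⟩_A`, by `inner_smul_conjHom_apply`. -/

namespace StarMorita

noncomputable section

/-! ### The conjugate of an equivalence bimodule -/

/-- The conjugate of a module over a commutative star ring: the same additive group, with scalars
acting through `star`. -/
def Conj (M : Type w) : Type w := M

namespace Conj

variable {S : Type*} [CommRing S] [StarRing S] {M : Type w} [AddCommGroup M] [Module S M]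

instance : AddCommGroup (Conj M) := inferInstanceAs (AddCommGroup M)

instance : Module S (Conj M) := Module.compHom M (starRingEnd S)

/-- The identity map onto the conjugate module. -/
def mk : M ≃+ Conj M := AddEquiv.refl M

/-- The identity map from the conjugate module. -/
def out : Conj M ≃+ M := AddEquiv.refl M

@[simp] theorem out_mk (x : M) : out (mk x) = x := rfl

@[simp] theorem mk_out (x : Conj M) : mk (out x) = x := rfl

@[simp] theorem out_smul (c : S) (x : Conj M) : out (c • x) = starRingEnd S c • out x := rfl

@[simp] theorem mk_smul (c : S) (x : M) : mk (c • x) = starRingEnd S c • mk x := by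
  change c • x = starRingEnd S (starRingEnd S c) • x
  simp

theorem span_image_mk {s : Set M} (hs : Submodule.span S s = ⊤) :
    Submodule.span S (mk '' s : Set (Conj M)) = ⊤ := by
  refine Submodule.eq_top_iff'.2 fun x => ?_
  have hx : out x ∈ Submodule.span S s := hs ▸ Submodule.mem_top
  rw [← mk_out x]
  generalize out x = y at hx
  induction hx using Submodule.span_induction with
  | mem x h => exact Submodule.subset_span ⟨x, h, rfl⟩
  | zero => rw [map_zero]; exact Submodule.zero_mem _
  | add x y _ _ hx hy => rw [map_add]; exact Submodule.add_mem _ hx hy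
  | smul c x _ hx => rw [mk_smul]; exact Submodule.smul_mem _ _ hx

end Conj

section Conjugate

variable {R : Type uR} [CommRing R] [LinearOrder R] [IsStrictOrderedRing R]
variable {B : Type uB} [NonUnitalRing B] [StarRing B] [Module (Cx R) B]
  [IsScalarTower (Cx R) B B] [SMulCommClass (Cx R) B B] [StarModule (Cx R) B]
variable {A : Type uA} [NonUnitalRing A] [StarRing A] [Module (Cx R) A]
  [IsScalarTower (Cx R) A A] [SMulCommClass (Cx R) A A] [StarModule (Cx R) A]

theorem SemiInnerBimodule.inner_ract_left (E : SemiInnerBimodule.{uR, uA, uB, w} R B A)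
    (a : A) (x y : E.carrier) : E.inner (E.ract a x) y = star a * E.inner x y := by
  rw [E.inner_star, E.inner_ract, star_mul, ← E.inner_star]

namespace EquivalenceBimodule

variable (E : EquivalenceBimodule.{uR, uA, uB, w} R B A)

theorem linner_lact_right (b : B) (x y : E.carrier) :
    E.linner x (E.lact b y) = E.linner x y * star b := by
  rw [E.linner_star, E.linner_lact, star_mul, ← E.linner_star]

/-- The conjugate `(A, B)`-bimodule of a strong Morita equivalence `(B, A)`-bimodule. -/
def conj : EquivalenceBimodule.{uR, uB, uA, w} R A B where
  carrier := Conj E.carrier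
  lact := LinearMap.mk₂ (Cx R) (fun a x => Conj.mk (E.ract (star a) (Conj.out x)))
    (by simp) (by simp [starRingEnd_apply]) (by simp) (by simp)
  lact_mul a a' x := by simp [E.ract_mul]
  ract := LinearMap.mk₂ (Cx R) (fun b x => Conj.mk (E.lact (star b) (Conj.out x)))
    (by simp) (by simp [starRingEnd_apply]) (by simp) (by simp)
  ract_mul b b' x := by simp [E.lact_mul]
  lact_ract a b x := by simp [E.lact_ract]
  -- Conjugating the scalars exchanges linear and antilinear slots, so the `B`-valued inner product,
  -- linear on the left over `E`, is linear on the right over `Ē`; its values are unchanged.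
  inner := LinearMap.mk₂'ₛₗ (starRingEnd (Cx R)) (RingHom.id (Cx R))
    (fun x y => E.linner (Conj.out x) (Conj.out y))
    (by simp) (by simp) (by simp) (by simp)
  inner_star x y := E.linner_star _ _
  inner_ract x y b := by simp [E.linner_lact_right]
  inner_lact a x y := by simp [E.linner_ract]
  inner_cp n x := E.linner_cp n fun i => Conj.out (x i)
  inner_nondeg y hy := by
    refine E.linner_nondeg _ fun x => (E.linner_star _ _).trans ?_
    exact (congrArg star (hy x)).trans (star_zero _)
  span_lact := by
    refine top_le_iff.1 ((Conj.span_image_mk E.span_ract).ge.trans (Submodule.span_mono ?_))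
    rintro _ ⟨_, ⟨a, x, rfl⟩, rfl⟩
    exact ⟨star a, Conj.mk x, by simp⟩
  span_ract := by
    refine top_le_iff.1 ((Conj.span_image_mk E.span_lact).ge.trans (Submodule.span_mono ?_))
    rintro _ ⟨_, ⟨b, x, rfl⟩, rfl⟩
    exact ⟨star b, Conj.mk x, by simp⟩
  linner := LinearMap.mk₂'ₛₗ (RingHom.id (Cx R)) (starRingEnd (Cx R))
    (fun x y => E.inner (Conj.out x) (Conj.out y))
    (by simp) (by simp) (by simp) (by simp)
  linner_star x y := E.inner_star _ _
  linner_lact a x y := by simp [E.inner_ract_left]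
  linner_ract b x y := by simp [E.inner_lact]
  linner_cp n x := E.inner_cp n fun i => Conj.out (x i)
  linner_nondeg x hx := by
    refine E.inner_nondeg _ fun y => (E.inner_star _ _).trans ?_
    exact (congrArg star (hx y)).trans (star_zero _)
  -- This is the compatibility of `E` for the triple `z, y, x`, once the stars from the conjugate
  -- actions have swapped the arguments of both inner products.
  linner_inner x y z := by
    simp [← E.inner_star, ← E.linner_star, E.linner_inner]
  span_inner := E.span_linner
  span_linner := E.span_inner

/-- The antilinear identity map onto the conjugate bimodule. -/
def toConj : E.carrier →ₗ⋆[Cx R] E.conj.carrier where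
  toFun := Conj.mk
  map_add' := map_add _
  map_smul' := Conj.mk_smul

/-- The antilinear identity map from the conjugate bimodule. -/
def ofConj : E.conj.carrier →ₗ⋆[Cx R] E.carrier where
  toFun := Conj.out
  map_add' := map_add _
  map_smul' c x := Conj.out_smul (M := E.carrier) c x

theorem toConj_surjective : Function.Surjective E.toConj := fun x => ⟨E.ofConj x, rfl⟩

@[simp] theorem conj_lact (a : A) (x : E.carrier) :
    E.conj.lact a (E.toConj x) = E.toConj (E.ract (star a) x) := rfl

@[simp] theorem conj_ract (b : B) (x : E.carrier) :
    E.conj.ract b (E.toConj x) = E.toConj (E.lact (star b) x) := rfl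

theorem ofConj_lact (a : A) (x : E.conj.carrier) :
    E.ofConj (E.conj.lact a x) = E.ract (star a) (E.ofConj x) := rfl

@[simp] theorem conj_inner (x y : E.carrier) :
    E.conj.inner (E.toConj x) (E.toConj y) = E.linner x y := rfl

end EquivalenceBimodule

/-! ### A nondegenerate idempotent algebra as a bimodule over itself -/

/-- The matrix is `X* X`, where `X` is the square matrix with `x` as its first row and zeros
elsewhere. -/
theorem isPosElem_star_mul_matrix (n : ℕ) (x : Fin n → A) :
    IsPosElem R (Matrix.of fun i j => star (x i) * x j : Matrix (Fin n) (Fin n) A) := by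
  cases n with
  -- For `n = 0` there is no first row to fill; the only matrix is zero.
  | zero =>
    rw [Subsingleton.elim (Matrix.of _ : Matrix (Fin 0) (Fin 0) A) 0]
    exact isPosElem_zero
  | succ n =>
    intro ω hω
    convert hω (Matrix.of fun i j => if i = 0 then x j else 0) using 2
    ext i j
    simp [Matrix.mul_apply]

/-- The identity equivalence bimodule of a nondegenerate idempotent `*`-algebra. -/
def EquivalenceBimodule.refl
    (hl : ∀ a : A, (∀ b, a * b = 0) → a = 0) (hr : ∀ a : A, (∀ b, b * a = 0) → a = 0)
    (hA : Submodule.span (Cx R) {c : A | ∃ a b, a * b = c} = ⊤) :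
    EquivalenceBimodule.{uR, uA, uA, uA} R A A where
  carrier := A
  lact := LinearMap.mul (Cx R) A
  lact_mul := mul_assoc
  ract := (LinearMap.mul (Cx R) A).flip
  ract_mul a a' x := (mul_assoc x a a').symm
  lact_ract b a x := (mul_assoc b x a).symm
  inner := LinearMap.mk₂'ₛₗ (starRingEnd (Cx R)) (RingHom.id (Cx R)) (fun x y => star x * y)
    (by simp [add_mul]) (fun c x y => by rw [star_smul, smul_mul_assoc, starRingEnd_apply])
    (by simp [mul_add]) (fun c x y => mul_smul_comm _ _ _)
  inner_star x y := by simp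
  inner_ract x y a := by simp [mul_assoc]
  inner_lact b x y := by simp [mul_assoc]
  inner_cp n x := isPosElem_star_mul_matrix n x
  inner_nondeg y hy := hr y fun b => by simpa using hy (star b)
  span_lact := hA
  span_ract := by
    refine top_le_iff.1 (hA.ge.trans (Submodule.span_mono ?_))
    rintro _ ⟨a, b, rfl⟩
    exact ⟨b, a, rfl⟩
  linner := LinearMap.mk₂'ₛₗ (RingHom.id (Cx R)) (starRingEnd (Cx R)) (fun x y => x * star y)
    (by simp [add_mul]) (fun c x y => smul_mul_assoc _ _ _) (by simp [mul_add])
    (fun c x y => by rw [star_smul, mul_smul_comm, starRingEnd_apply])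
  linner_star x y := by simp
  linner_lact b x y := by simp [mul_assoc]
  linner_ract b x y := by simp [mul_assoc]
  linner_cp n x := by simpa using isPosElem_star_mul_matrix (R := R) n fun i => star (x i)
  linner_nondeg x hx := hl x fun b => by simpa using hx (star b)
  linner_inner x y z := by simp [mul_assoc]
  span_inner := by
    refine top_le_iff.1 (hA.ge.trans (Submodule.span_mono ?_))
    rintro _ ⟨a, b, rfl⟩
    exact ⟨star a, b, by simp⟩
  span_linner := by
    refine top_le_iff.1 (hA.ge.trans (Submodule.span_mono ?_))
    rintro _ ⟨a, b, rfl⟩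
    exact ⟨a, star b, by simp⟩

end Conjugate

/-! ### The tensor product of equivalence bimodules -/

namespace SemiInnerBimodule

variable {R : Type uR} [CommRing R] [LinearOrder R] [IsStrictOrderedRing R]
variable {B : Type uB} [NonUnitalRing B] [StarRing B] [Module (Cx R) B]
  [IsScalarTower (Cx R) B B] [SMulCommClass (Cx R) B B] [StarModule (Cx R) B]
variable {A : Type uA} [NonUnitalRing A] [StarRing A] [Module (Cx R) A]
  [IsScalarTower (Cx R) A A] [SMulCommClass (Cx R) A A] [StarModule (Cx R) A]
variable {D : Type uD} [NonUnitalRing D] [StarRing D] [Module (Cx R) D]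
  [IsScalarTower (Cx R) D D] [SMulCommClass (Cx R) D D] [StarModule (Cx R) D]
variable (E : SemiInnerBimodule.{uR, uA, uB, w} R B A)
  (H : SemiInnerBimodule.{uR, uD, uA, w} R A D)

theorem btmul_add (x : E.carrier) (h h' : H.carrier) :
    E.btmul H x (h + h') = E.btmul H x h + E.btmul H x h' := by
  simp [btmul, TensorProduct.tmul_add]

theorem add_btmul (x x' : E.carrier) (h : H.carrier) :
    E.btmul H (x + x') h = E.btmul H x h + E.btmul H x' h := by
  simp [btmul, TensorProduct.add_tmul]

theorem btmul_smul (c : Cx R) (x : E.carrier) (h : H.carrier) :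
    E.btmul H x (c • h) = c • E.btmul H x h := by
  simp [btmul]

theorem smul_btmul (c : Cx R) (x : E.carrier) (h : H.carrier) :
    E.btmul H (c • x) h = c • E.btmul H x h := by
  simp [btmul, ← TensorProduct.smul_tmul']

end SemiInnerBimodule

/-! ### The left inner product on `F ⊗_B E` and the comparison of degeneracy spaces -/

namespace EquivalenceBimodule

open SemiInnerBimodule

variable {R : Type uR} [CommRing R] [LinearOrder R] [IsStrictOrderedRing R]
variable {B : Type uB} [NonUnitalRing B] [StarRing B] [Module (Cx R) B]
  [IsScalarTower (Cx R) B B] [SMulCommClass (Cx R) B B] [StarModule (Cx R) B]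
variable {A : Type uA} [NonUnitalRing A] [StarRing A] [Module (Cx R) A]
  [IsScalarTower (Cx R) A A] [SMulCommClass (Cx R) A A] [StarModule (Cx R) A]
variable {C : Type uD} [NonUnitalRing C] [StarRing C] [Module (Cx R) C]
  [IsScalarTower (Cx R) C C] [SMulCommClass (Cx R) C C] [StarModule (Cx R) C]
variable (F : EquivalenceBimodule.{uR, uB, uD, w} R C B)
  (E : EquivalenceBimodule.{uR, uA, uB, w} R B A)

/-- The antilinear flip `x ⊗ h ↦ h̄ ⊗ x̄` from `F ⊗_B E` to the tensor product of the conjugate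
bimodules. -/
def flipConj : F.BalTensor E.toSemiInnerBimodule →ₗ⋆[Cx R]
    E.conj.BalTensor F.conj.toSemiInnerBimodule :=
  (F.balanced E.toSemiInnerBimodule).liftQ
    (TensorProduct.lift (LinearMap.mk₂'ₛₗ (starRingEnd (Cx R)) (starRingEnd (Cx R))
      (fun x h => E.conj.btmul F.conj.toSemiInnerBimodule (E.toConj h) (F.toConj x))
      (fun x x' h => by rw [map_add, btmul_add])
      (fun c x h => by rw [LinearMap.map_smulₛₗ, btmul_smul])
      (fun x h h' => by rw [map_add, add_btmul])
      (fun c x h => by rw [LinearMap.map_smulₛₗ, smul_btmul]))) <| by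
    refine Submodule.span_le.2 ?_
    rintro _ ⟨b, x, h, rfl⟩
    rw [SetLike.mem_coe, LinearMap.mem_ker, map_sub, sub_eq_zero]
    -- The balancing relation for `b` becomes the one for `b*` with the factors reversed: `h̄ · b*`
    -- is the conjugate of `b · h`, and `b* · x̄` that of `x · b`.
    have := btmul_ract (E := E.conj.toSemiInnerBimodule) (H := F.conj.toSemiInnerBimodule)
      (star b) (E.toConj h) (F.toConj x)
    rw [conj_lact, conj_ract, star_star] at this
    exact this.symm

/-- The left inner product on `F ⊗_B E`. -/
def tensorLinner : F.BalTensor E.toSemiInnerBimodule →ₗ[Cx R]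
    F.BalTensor E.toSemiInnerBimodule →ₗ⋆[Cx R] C :=
  LinearMap.mk₂'ₛₗ (RingHom.id (Cx R)) (starRingEnd (Cx R))
    -- On elementary tensors this is `_C⟨x, y · _B⟨h,k⟩*⟩`. Pulling back along the flip lets
    -- hermitian symmetry and complete positivity be inherited.
    (fun s t => E.conj.tensorInner F.conj.toSemiInnerBimodule (F.flipConj E s) (F.flipConj E t))
    (fun s s' t => by rw [map_add, map_add, LinearMap.add_apply])
    (fun c s t => by
      rw [LinearMap.map_smulₛₗ, LinearMap.map_smulₛₗ, LinearMap.smul_apply]; simp)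
    (fun s t t' => by rw [map_add, map_add])
    (fun c s t => by rw [LinearMap.map_smulₛₗ, LinearMap.map_smulₛₗ]; simp)

theorem tensorLinner_star (s t : F.BalTensor E.toSemiInnerBimodule) :
    F.tensorLinner E s t = star (F.tensorLinner E t s) :=
  tensorInner_star _ _ _ _

theorem tensorLinner_cp (n : ℕ) (u : Fin n → F.BalTensor E.toSemiInnerBimodule) :
    IsPosElem R (Matrix.of fun i j => F.tensorLinner E (u i) (u j) :
      Matrix (Fin n) (Fin n) C) :=
  tensorInner_cp _ _ n fun i => F.flipConj E (u i)

theorem tensorLinner_lact (c : C) (s t : F.BalTensor E.toSemiInnerBimodule) :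
    F.tensorLinner E (F.tensorLact E.toSemiInnerBimodule c s) t = c * F.tensorLinner E s t := by
  induction s using balTensor_induction with
  | zero => simp
  | add s s' hs hs' => simp [hs, hs', mul_add]
  | tmul x h =>
    induction t using balTensor_induction with
    | zero => simp
    | add t t' ht ht' => simp [ht, ht', mul_add]
    | tmul y k => exact F.linner_lact _ _ _

theorem tensorLinner_ract (a : A) (s t : F.BalTensor E.toSemiInnerBimodule) :
    F.tensorLinner E (F.tensorRact E.toSemiInnerBimodule a s) t =
      F.tensorLinner E s (F.tensorRact E.toSemiInnerBimodule (star a) t) := by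
  induction s using balTensor_induction with
  | zero => simp
  | add s s' hs hs' => simp [hs, hs']
  | tmul x h =>
    induction t using balTensor_induction with
    | zero => simp
    | add t t' ht ht' => simp [ht, ht']
    | tmul y k =>
      change F.linner x (F.ract (star (E.linner (E.ract a h) k)) y) =
        F.linner x (F.ract (star (E.linner h (E.ract (star a) k))) y)
      rw [E.linner_ract]

/-- Put `b = _B⟨h,k⟩`. Compatibility in `F` turns the left side into `x · (b⟨y,z⟩) ⊗ l`; the element
of `B` then crosses the tensor sign, and compatibility in `E` rewrites `b (⟨y,z⟩ l)` as `h ⟨k, ⟨y,z⟩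
l⟩`. No quotient by degeneracy is needed, so the identity can compare the two degeneracy spaces. -/
theorem tensorLinner_inner (s t u : F.BalTensor E.toSemiInnerBimodule) :
    F.tensorLact E.toSemiInnerBimodule (F.tensorLinner E s t) u =
      F.tensorRact E.toSemiInnerBimodule (F.tensorInner E.toSemiInnerBimodule t u) s := by
  induction s using balTensor_induction with
  | zero => simp
  | add s s' hs hs' => simp [hs, hs']
  | tmul x h =>
    induction t using balTensor_induction with
    | zero => simp
    | add t t' ht ht' => simp [ht, ht']
    | tmul y k =>
      induction u using balTensor_induction with
      | zero => simp
      | add u u' hu hu' => simp [hu, hu']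
      | tmul z l =>
        change F.btmul E.toSemiInnerBimodule
            (F.lact (F.linner x (F.ract (star (E.linner h k)) y)) z) l =
          F.btmul E.toSemiInnerBimodule x (E.ract (E.inner k (E.lact (F.inner y z) l)) h)
        rw [F.linner_inner, F.inner_ract_left, star_star, btmul_ract, E.lact_mul, E.linner_inner]

/-- The `⟨x,y⟩` span `B`, then `B · E = E`, then the `⟨h,k⟩` span `A`. These are the inner products
of elementary tensors, so this gives fullness of the tensor product. -/
theorem span_inner_lact_inner : Submodule.span (Cx R)
    {a | ∃ x y h k, E.inner h (E.lact (F.inner x y) k) = a} = ⊤ := by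
  set V := Submodule.span (Cx R) {a | ∃ x y h k, E.inner h (E.lact (F.inner x y) k) = a} with hV
  refine top_le_iff.1 (E.span_inner.ge.trans (Submodule.span_le.2 ?_))
  rintro _ ⟨h, k, rfl⟩
  suffices ⊤ ≤ V.comap (E.inner h) from this (Submodule.mem_top (x := k))
  refine E.span_lact.ge.trans (Submodule.span_le.2 ?_)
  rintro _ ⟨b, k, rfl⟩
  suffices ⊤ ≤ V.comap (E.inner h ∘ₗ E.lact.flip k) from this (Submodule.mem_top (x := b))
  refine F.span_inner.ge.trans (Submodule.span_le.2 ?_)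
  rintro _ ⟨x, y, rfl⟩
  exact Submodule.subset_span ⟨x, y, h, k, rfl⟩

theorem span_tensorInner :
    Submodule.span (Cx R) {a | ∃ s t, F.tensorInner E.toSemiInnerBimodule s t = a} = ⊤ := by
  refine top_le_iff.1 ((F.span_inner_lact_inner E).ge.trans (Submodule.span_mono ?_))
  rintro _ ⟨x, y, h, k, rfl⟩
  exact ⟨F.btmul _ x h, F.btmul _ y k, rfl⟩

theorem span_tensorLinner :
    Submodule.span (Cx R) {a | ∃ s t, F.tensorLinner E s t = a} = ⊤ := by
  refine top_le_iff.1 ((E.conj.span_inner_lact_inner F.conj).ge.trans (Submodule.span_mono ?_))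
  rintro _ ⟨x, y, h, k, rfl⟩
  obtain ⟨x, rfl⟩ := E.toConj_surjective x
  obtain ⟨y, rfl⟩ := E.toConj_surjective y
  obtain ⟨h, rfl⟩ := F.toConj_surjective h
  obtain ⟨k, rfl⟩ := F.toConj_surjective k
  exact ⟨F.btmul _ h x, F.btmul _ k y, rfl⟩

/-- For all `u, v`, `_C⟨s,t⟩ _C⟨u,v⟩ = _C⟨s⟨t,u⟩, v⟩ = 0`. By fullness `_C⟨s,t⟩` annihilates `C`,
hence vanishes. -/
theorem tensorLinner_eq_zero_of_mem_perp (hC : ∀ c : C, (∀ b, c * b = 0) → c = 0)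
    {t : F.BalTensor E.toSemiInnerBimodule} (ht : t ∈ (F.tensor E.toSemiInnerBimodule).perp)
    (s : F.BalTensor E.toSemiInnerBimodule) : F.tensorLinner E s t = 0 := by
  refine hC _ fun b => ?_
  suffices ⊤ ≤ LinearMap.ker (LinearMap.mulLeft (Cx R) (F.tensorLinner E s t)) from
    this (Submodule.mem_top (x := b))
  refine (F.span_tensorLinner E).ge.trans (Submodule.span_le.2 ?_)
  rintro _ ⟨u, v, rfl⟩
  change F.tensorLinner E s t * F.tensorLinner E u v = 0
  have h : F.tensorInner E.toSemiInnerBimodule t u = 0 := inner_eq_zero_of_mem_perp _ ht u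
  rw [← tensorLinner_lact, tensorLinner_inner, h]
  simp

/-- The mirror argument: `⟨u,v⟩⟨t,s⟩ = ⟨u, v⟨t,s⟩⟩ = ⟨u, _C⟨v,t⟩ s⟩ = 0`, and the `⟨u,v⟩` span `A`.
-/
theorem mem_perp_of_tensorLinner_eq_zero (hA : ∀ a : A, (∀ b, b * a = 0) → a = 0)
    {t : F.BalTensor E.toSemiInnerBimodule} (ht : ∀ s, F.tensorLinner E t s = 0) :
    t ∈ (F.tensor E.toSemiInnerBimodule).perp := by
  intro (s : F.BalTensor E.toSemiInnerBimodule)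
  refine (tensorInner_star _ _ _ _).trans (star_eq_zero.2 ?_)
  refine hA _ fun b => ?_
  suffices ⊤ ≤ LinearMap.ker (LinearMap.mulRight (Cx R) (F.tensorInner E.toSemiInnerBimodule t s)) from
    this (Submodule.mem_top (x := b))
  refine (F.span_tensorInner E).ge.trans (Submodule.span_le.2 ?_)
  rintro _ ⟨u, v, rfl⟩
  change F.tensorInner E.toSemiInnerBimodule u v * F.tensorInner E.toSemiInnerBimodule t s = 0
  refine ((F.tensor E.toSemiInnerBimodule).inner_ract u v _).symm.trans ?_
  have h : F.tensorRact E.toSemiInnerBimodule (F.tensorInner E.toSemiInnerBimodule t s) v = 0 := by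
    rw [← tensorLinner_inner, tensorLinner_star, ht]
    simp
  exact (congrArg _ h).trans (map_zero _)

/-- The equivalence bimodule `F ⊗̂_B E`. -/
def trans (hC : ∀ c : C, (∀ b, c * b = 0) → c = 0) (hA : ∀ a : A, (∀ b, b * a = 0) → a = 0) :
    EquivalenceBimodule.{uR, uA, uD, w} R C A where
  toPreHilbertBimodule := F.toPreHilbertBimodule.hatTensor E.toPreHilbertBimodule
  span_lact := hatTensor_stronglyNondegenerate _ F.span_lact _
  span_ract := by
    refine Submodule.eq_top_iff'.2 fun t => ?_
    induction t using Submodule.Quotient.induction_on with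
    | H t =>
      induction t using SemiInnerBimodule.balTensor_induction with
      | zero => exact Submodule.zero_mem _
      | add s t hs ht => exact Submodule.add_mem _ hs ht
      | tmul x h =>
        let q : E.carrier →ₗ[Cx R] (F.hatTensor E.toPreHilbertBimodule).carrier :=
          (F.tensor E.toSemiInnerBimodule).perp.mkQ ∘ₗ
            (F.balanced E.toSemiInnerBimodule).mkQ ∘ₗ
              (TensorProduct.mk (Cx R) F.carrier E.carrier) x
        have hx : h ∈ Submodule.span (Cx R) {z | ∃ b x, E.ract b x = z} :=
          E.span_ract ▸ Submodule.mem_top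
        have := Submodule.mem_map_of_mem (f := q) hx
        rw [Submodule.map_span] at this
        refine Submodule.span_mono ?_ this
        rintro _ ⟨_, ⟨b, y, rfl⟩, rfl⟩
        exact ⟨b, q y, rfl⟩
  -- The quotient is by the degeneracy space of the right inner product; the left one descends
  -- because it vanishes there too.
  linner := (F.tensor E.toSemiInnerBimodule).perp.liftQ
    { toFun := fun s => (F.tensor E.toSemiInnerBimodule).perp.liftQ (F.tensorLinner E s)
        fun _ ht => F.tensorLinner_eq_zero_of_mem_perp E hC ht s
      map_add' := fun s s' => by
        refine LinearMap.ext fun t => ?_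
        induction t using Submodule.Quotient.induction_on with | H t => ?_
        exact LinearMap.map_add₂ (F.tensorLinner E) s s' t
      map_smul' := fun c s => by
        refine LinearMap.ext fun t => ?_
        induction t using Submodule.Quotient.induction_on with | H t => ?_
        exact LinearMap.congr_fun (map_smul (F.tensorLinner E) c s) t }
    fun s hs => by
      rw [LinearMap.mem_ker]
      refine LinearMap.ext fun t => ?_
      induction t using Submodule.Quotient.induction_on with | H t => ?_
      exact (F.tensorLinner_star E s t).trans
        (star_eq_zero.2 (F.tensorLinner_eq_zero_of_mem_perp E hC hs t))
  linner_star s t := by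
    induction s using Submodule.Quotient.induction_on with
    | H s =>
      induction t using Submodule.Quotient.induction_on with
      | H t => exact F.tensorLinner_star E s t
  linner_lact c s t := by
    induction s using Submodule.Quotient.induction_on with
    | H s =>
      induction t using Submodule.Quotient.induction_on with
      | H t => exact F.tensorLinner_lact E c s t
  linner_ract a s t := by
    induction s using Submodule.Quotient.induction_on with
    | H s =>
      induction t using Submodule.Quotient.induction_on with
      | H t => exact F.tensorLinner_ract E a s t
  linner_cp n u := by
    choose v hv using fun i => Submodule.Quotient.mk_surjective (F.tensor E.toSemiInnerBimodule).perp (u i)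
    obtain rfl : (fun i => Submodule.Quotient.mk (v i)) = u := funext hv
    exact F.tensorLinner_cp E n v
  linner_nondeg s hs := by
    induction s using Submodule.Quotient.induction_on with
    | H s =>
      refine (Submodule.Quotient.mk_eq_zero _).2 ?_
      exact F.mem_perp_of_tensorLinner_eq_zero E hA fun t => hs (Submodule.Quotient.mk t)
  linner_inner s t u := by
    induction s using Submodule.Quotient.induction_on with
    | H s =>
      induction t using Submodule.Quotient.induction_on with
      | H t =>
        induction u using Submodule.Quotient.induction_on with
        | H u =>
          exact congrArg (Submodule.Quotient.mk (p := (F.tensor E.toSemiInnerBimodule).perp))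
            (F.tensorLinner_inner E s t u)
  span_inner := by
    refine top_le_iff.1 ((F.span_tensorInner E).ge.trans (Submodule.span_mono ?_))
    rintro _ ⟨s, t, rfl⟩
    exact ⟨Submodule.Quotient.mk s, Submodule.Quotient.mk t, rfl⟩
  span_linner := by
    refine top_le_iff.1 ((F.span_tensorLinner E).ge.trans (Submodule.span_mono ?_))
    rintro _ ⟨s, t, rfl⟩
    exact ⟨Submodule.Quotient.mk s, Submodule.Quotient.mk t, rfl⟩

end EquivalenceBimodule

theorem stronglyMoritaEquivalent_equivalence (R : Type uR) [CommRing R] [LinearOrder R]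
    [IsStrictOrderedRing R] :
    _root_.Equivalence fun A B : NondegIdemStarAlgebra.{uR, uA} R =>
      StronglyMoritaEquivalent R A.carrier B.carrier where
  refl A := ⟨.refl (fun a h => A.nondegenerate a (.inl h)) (fun a h => A.nondegenerate a (.inr h))
    A.idempotent⟩
  symm := fun ⟨E⟩ => ⟨E.conj⟩
  trans {A _ C} := fun ⟨E⟩ ⟨F⟩ => ⟨F.trans E (fun c h => C.nondegenerate c (.inl h))
    (fun a h => A.nondegenerate a (.inr h))⟩

/-! ### Rieffel induction is an equivalence of categories -/

/-- A functor with a left inverse that itself has a left inverse is an equivalence. -/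
def equivalenceOfLeftInverses {𝒞 𝒟 : Type*} [Category 𝒞] [Category 𝒟] (F : 𝒞 ⥤ 𝒟)
    (G : 𝒟 ⥤ 𝒞) (F' : 𝒞 ⥤ 𝒟) (η : F ⋙ G ≅ 𝟭 𝒞) (ε : G ⋙ F' ≅ 𝟭 𝒟) : 𝒞 ≌ 𝒟 :=
  CategoryTheory.Equivalence.mk F G η.symm <|
    -- The outer inverses agree: `F ≅ F ⋙ G ⋙ F' ≅ F'`. Hence `G ⋙ F ≅ G ⋙ F' ≅ 𝟭`.
    Functor.isoWhiskerLeft G (F.rightUnitor.symm ≪≫ Functor.isoWhiskerLeft F ε.symm ≪≫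
      (Functor.associator F G F').symm ≪≫ Functor.isoWhiskerRight η F' ≪≫ F'.leftUnitor) ≪≫ ε

section Rieffel

variable {R : Type uR} [CommRing R] [LinearOrder R] [IsStrictOrderedRing R]
variable {B : Type uB} [NonUnitalRing B] [StarRing B] [Module (Cx R) B]
  [IsScalarTower (Cx R) B B] [SMulCommClass (Cx R) B B] [StarModule (Cx R) B]
variable {A : Type uA} [NonUnitalRing A] [StarRing A] [Module (Cx R) A]
  [IsScalarTower (Cx R) A A] [SMulCommClass (Cx R) A A] [StarModule (Cx R) A]
variable {D : Type uD} [NonUnitalRing D] [StarRing D] [Module (Cx R) D]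
  [IsScalarTower (Cx R) D D] [SMulCommClass (Cx R) D D] [StarModule (Cx R) D]

/-- A bijective isometric intertwiner is an isomorphism. -/
def PreHilbertBimodule.isoOfIsometry {H K : PreHilbertBimodule.{uR, uD, uA, w} R A D}
    (e : H.carrier ≃ₗ[Cx R] K.carrier) (he : ∀ x y, K.inner (e x) (e y) = H.inner x y)
    (hl : ∀ a x, e (H.lact a x) = K.lact a (e x)) : H ≅ K where
  hom := PreHilbertBimodule.Hom.mk e.toLinearMap
    ⟨e.symm.toLinearMap, fun x y => by
      rw [LinearEquiv.coe_coe, LinearEquiv.coe_coe, ← he, LinearEquiv.apply_symm_apply]⟩ hl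
  inv := PreHilbertBimodule.Hom.mk e.symm.toLinearMap
    ⟨e.toLinearMap, fun x y => by
      rw [LinearEquiv.coe_coe, LinearEquiv.coe_coe, ← he, LinearEquiv.apply_symm_apply]⟩
    fun a x => by
      rw [LinearEquiv.coe_coe, LinearEquiv.symm_apply_eq, hl, LinearEquiv.apply_symm_apply]
  hom_inv_id := PreHilbertBimodule.Hom.ext (LinearMap.ext e.symm_apply_apply)
  inv_hom_id := PreHilbertBimodule.Hom.ext (LinearMap.ext e.apply_symm_apply)

namespace SemiInnerBimodule

variable {S : SemiInnerBimodule.{uR, uD, uA, w} R A D}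
  {H : PreHilbertBimodule.{uR, uD, uA, w} R A D} (φ : S.carrier →ₗ[Cx R] H.carrier)

/-- Surjectivity allows non-degeneracy of `H` to be tested on the vectors `φ s` alone, where the
isometry turns it into orthogonality in `S`. -/
theorem ker_eq_perp_of_isometry (hs : Function.Surjective φ)
    (hi : ∀ s t, H.inner (φ s) (φ t) = S.inner s t) : LinearMap.ker φ = S.perp := by
  ext t
  refine ⟨fun ht s => ?_, fun ht => H.inner_nondeg _ fun h => ?_⟩
  · rw [← hi, LinearMap.mem_ker.1 ht, map_zero]
  · obtain ⟨s, rfl⟩ := hs h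
    exact (hi s t).trans (ht s)

/-- A surjective isometric intertwiner from a semi-inner product bimodule identifies the quotient
by the degeneracy space with its target. -/
def quotPerpIso (hs : Function.Surjective φ) (hi : ∀ s t, H.inner (φ s) (φ t) = S.inner s t)
    (hl : ∀ a s, φ (S.lact a s) = H.lact a (φ s)) : S.quotPerp ≅ H :=
  PreHilbertBimodule.isoOfIsometry
    ((Submodule.quotEquivOfEq _ _ (ker_eq_perp_of_isometry φ hs hi).symm).trans
      (φ.quotKerEquivOfSurjective hs))
    (fun x y => by
      induction x using Submodule.Quotient.induction_on with
      | H x =>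
        induction y using Submodule.Quotient.induction_on with
        | H y => exact hi x y)
    (fun a x => by
      induction x using Submodule.Quotient.induction_on with
      | H x => exact hl a x)

end SemiInnerBimodule

/-! ### The evaluation isomorphism from `Ē ⊗̂_B (E ⊗̂_A H)` to `H` -/

namespace EquivalenceBimodule

open SemiInnerBimodule

variable (E : EquivalenceBimodule.{uR, uA, uB, w} R B A)

section Evaluation

variable (H : PreHilbertBimodule.{uR, uD, uA, w} R A D)

/-- The map `y ⊗ h ↦ ⟨x, y⟩ · h` on `E ⊗_A H`. -/
def contract (x : E.carrier) : E.BalTensor H.toSemiInnerBimodule →ₗ[Cx R] H.carrier :=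
  (E.balanced H.toSemiInnerBimodule).liftQ
    (TensorProduct.lift (LinearMap.mk₂ (Cx R) (fun y h => H.lact (E.inner x y) h)
      (by simp) (by simp) (by simp) (by simp))) <| by
    refine Submodule.span_le.2 ?_
    rintro _ ⟨a, y, k, rfl⟩
    simp [E.inner_ract, H.lact_mul]

/-- Contraction with `x` is formally adjoint to `h ↦ x ⊗ h`. It therefore kills the degeneracy space
and descends to `E ⊗̂_A H`. -/
theorem inner_contract (x : E.carrier) (h : H.carrier)
    (t : E.BalTensor H.toSemiInnerBimodule) : H.inner h (E.contract H x t) =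
      E.tensorInner H.toSemiInnerBimodule (E.btmul H.toSemiInnerBimodule x h) t := by
  induction t using balTensor_induction with
  | zero => simp
  | add s t hs ht => simp [hs, ht]
  | tmul y k => rfl

/-- The map `y ⊗ h ↦ ⟨x, y⟩ · h` on `E ⊗̂_A H`. -/
def hatContract (x : E.carrier) :
    (E.hatTensor H).carrier →ₗ[Cx R] H.carrier :=
  (E.tensor H.toSemiInnerBimodule).perp.liftQ (E.contract H x) fun t ht =>
    H.inner_nondeg _ fun h => (E.inner_contract H x h t).trans (ht _)

/-- The class of `y ⊗ h` in `E ⊗̂_A H`. -/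
def hmul (y : E.carrier) (h : H.carrier) : (E.hatTensor H).carrier :=
  (E.tensor H.toSemiInnerBimodule).perp.mkQ (E.btmul H.toSemiInnerBimodule y h)

variable {H} in
theorem hatTensor_induction {p : (E.hatTensor H).carrier → Prop} (t : (E.hatTensor H).carrier)
    (zero : p 0) (hmul : ∀ y h, p (E.hmul H y h)) (add : ∀ s t, p s → p t → p (s + t)) : p t := by
  induction t using Submodule.Quotient.induction_on with
  | H t =>
    induction t using balTensor_induction with
    | zero => exact zero
    | tmul y h => exact hmul y h
    | add s t hs ht => exact add _ _ hs ht

theorem hatContract_hmul (x y : E.carrier) (h : H.carrier) :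
    E.hatContract H x (E.hmul H y h) = H.lact (E.inner x y) h := rfl

theorem lact_hmul (b : B) (y : E.carrier) (h : H.carrier) :
    (E.hatTensor H).lact b (E.hmul H y h) = E.hmul H (E.lact b y) h := rfl

theorem inner_hmul (x y : E.carrier) (h k : H.carrier) :
    (E.hatTensor H).inner (E.hmul H x h) (E.hmul H y k) = H.inner h (H.lact (E.inner x y) k) :=
  rfl

/-- This is the balancing over `B` that makes the evaluation well defined; `hatContract_ract`
supplies its `A`-linearity. -/
theorem hatContract_lact (b : B) (x : E.carrier) (t : (E.hatTensor H).carrier) :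
    E.hatContract H x ((E.hatTensor H).lact b t) = E.hatContract H (E.lact (star b) x) t := by
  induction t using E.hatTensor_induction with
  | zero => simp
  | add s t hs ht => simp [hs, ht]
  | hmul y h => rw [lact_hmul, hatContract_hmul, hatContract_hmul, E.inner_lact, star_star]

theorem hatContract_ract (a : A) (x : E.carrier) (t : (E.hatTensor H).carrier) :
    E.hatContract H (E.ract a x) t = H.lact (star a) (E.hatContract H x t) := by
  induction t using E.hatTensor_induction with
  | zero => simp
  | add s t hs ht => simp [hs, ht]
  | hmul y h => rw [hatContract_hmul, hatContract_hmul, E.inner_ract_left, H.lact_mul]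

theorem hatContract_add (x x' : E.carrier) :
    E.hatContract H (x + x') = E.hatContract H x + E.hatContract H x' := by
  refine LinearMap.ext fun t => ?_
  induction t using E.hatTensor_induction with
  | zero => simp
  | add s t hs ht => rw [map_add, map_add, hs, ht]
  | hmul y h => simp [hatContract_hmul]

theorem hatContract_smul (c : Cx R) (x : E.carrier) :
    E.hatContract H (c • x) = starRingEnd (Cx R) c • E.hatContract H x := by
  refine LinearMap.ext fun t => ?_
  induction t using E.hatTensor_induction with
  | zero => simp
  | add s t hs ht => rw [map_add, map_add, hs, ht]
  | hmul y h => simp [hatContract_hmul]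

/-- The evaluation `x̄ ⊗ (y ⊗ h) ↦ ⟨x, y⟩ · h` from `Ē ⊗_B (E ⊗̂_A H)` to `H`. -/
def evaluation : E.conj.BalTensor (E.hatTensor H).toSemiInnerBimodule →ₗ[Cx R] H.carrier :=
  (E.conj.balanced (E.hatTensor H).toSemiInnerBimodule).liftQ
    (TensorProduct.lift (LinearMap.mk₂ (Cx R) (fun x t => E.hatContract H (E.ofConj x) t)
      (fun x x' t => by rw [map_add, hatContract_add, LinearMap.add_apply])
      (fun c x t => by
        rw [LinearMap.map_smulₛₗ, hatContract_smul, RingHomCompTriple.comp_apply,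
          RingHom.id_apply, LinearMap.smul_apply])
      (fun x t t' => map_add _ _ _) (fun c x t => map_smul _ _ _))) <| by
    refine Submodule.span_le.2 ?_
    rintro _ ⟨b, x, t, rfl⟩
    obtain ⟨x, rfl⟩ := E.toConj_surjective x
    rw [SetLike.mem_coe, LinearMap.mem_ker, map_sub, sub_eq_zero]
    exact (E.hatContract_lact H b x t).symm

theorem evaluation_btmul (x : E.carrier) (t : (E.hatTensor H).carrier) :
    E.evaluation H (E.conj.btmul (E.hatTensor H).toSemiInnerBimodule (E.toConj x) t) =
      E.hatContract H x t := rfl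

/-- On generators, `⟨⟨x,y⟩h, ⟨x',y'⟩h'⟩ = ⟨h, ⟨y, x⟨x',y'⟩⟩ h'⟩`, and compatibility replaces
`x⟨x',y'⟩` by `_B⟨x,x'⟩ y'`, the expression defining the inner product on the iterated tensor
product. -/
theorem inner_evaluation (s t : E.conj.BalTensor (E.hatTensor H).toSemiInnerBimodule) :
    H.inner (E.evaluation H s) (E.evaluation H t) =
      E.conj.tensorInner (E.hatTensor H).toSemiInnerBimodule s t := by
  induction s using balTensor_induction with
  | zero => simp
  | add s s' hs hs' => simp [hs, hs']
  | tmul x u =>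
    induction t using balTensor_induction with
    | zero => simp
    | add t t' ht ht' => simp [ht, ht']
    | tmul x' u' =>
      obtain ⟨x, rfl⟩ := E.toConj_surjective x
      obtain ⟨x', rfl⟩ := E.toConj_surjective x'
      rw [tensorInner_btmul, evaluation_btmul, evaluation_btmul, conj_inner]
      induction u using E.hatTensor_induction with
      | zero => simp
      | add s s' hs hs' => simp [hs, hs']
      | hmul y h =>
        induction u' using E.hatTensor_induction with
        | zero => simp
        | add t t' ht ht' => simp [ht, ht']
        | hmul y' h' =>
          rw [hatContract_hmul, hatContract_hmul, lact_hmul, inner_hmul, E.linner_inner,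
            E.inner_ract, H.inner_lact, H.lact_mul, ← E.inner_star]

theorem evaluation_lact (a : A) (t : E.conj.BalTensor (E.hatTensor H).toSemiInnerBimodule) :
    E.evaluation H (E.conj.tensorLact (E.hatTensor H).toSemiInnerBimodule a t) =
      H.lact a (E.evaluation H t) := by
  induction t using balTensor_induction with
  | zero => simp
  | add s t hs ht => simp [hs, ht]
  | tmul x t =>
    obtain ⟨x, rfl⟩ := E.toConj_surjective x
    refine (E.hatContract_ract H (star a) x t).trans ?_
    rw [star_star]
    rfl

theorem evaluation_surjective
    (hH : Submodule.span (Cx R) {z | ∃ a x, H.lact a x = z} = ⊤) :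
    Function.Surjective (E.evaluation H) := by
  rw [← LinearMap.range_eq_top, ← top_le_iff]
  refine hH.ge.trans (Submodule.span_le.2 ?_)
  rintro _ ⟨a, h, rfl⟩
  suffices ⊤ ≤ (LinearMap.range (E.evaluation H)).comap (H.lact.flip h) from
    this (Submodule.mem_top (x := a))
  refine E.span_inner.ge.trans (Submodule.span_le.2 ?_)
  rintro _ ⟨x, y, rfl⟩
  exact ⟨E.conj.btmul _ (E.toConj x) (E.hmul H y h), rfl⟩

variable {H} {K : PreHilbertBimodule.{uR, uD, uA, w} R A D} (T : PreHilbertBimodule.Hom H K)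

theorem hatContract_hatTensorMap (x : E.carrier) (t : (E.hatTensor H).carrier) :
    E.hatContract K x ((E.hatTensorMap T).toLin t) = T.toLin (E.hatContract H x t) := by
  induction t using E.hatTensor_induction with
  | zero => simp
  | add s t hs ht => simp [hs, ht]
  | hmul y h => exact (T.intertwines (E.inner x y) h).symm

theorem evaluation_balMap (t : E.conj.BalTensor (E.hatTensor H).toSemiInnerBimodule) :
    E.evaluation K (balMap (E := E.conj.toSemiInnerBimodule) (E' := E.conj.toSemiInnerBimodule)
      (H' := (E.hatTensor K).toSemiInnerBimodule) LinearMap.id (E.hatTensorMap T).toLin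
      (fun _ _ => rfl) (E.hatTensorMap T).intertwines t) = T.toLin (E.evaluation H t) := by
  induction t using balTensor_induction with
  | zero => simp
  | add s t hs ht => simp [hs, ht]
  | tmul x t =>
    obtain ⟨x, rfl⟩ := E.toConj_surjective x
    exact E.hatContract_hatTensorMap T x t

end Evaluation

/-- Rieffel induction along the conjugate bimodule inverts Rieffel induction. -/
def rieffelRepConjIso : rieffelRep.{uR, uA, uB, uD, w} (D := D) E ⋙ rieffelRep E.conj ≅
    𝟭 (Rep.{uR, uA, uD, w} R A D) :=
  NatIso.ofComponents
    (fun H => (IsStronglyNondegenerate R A D).isoMk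
      (quotPerpIso (E.evaluation H.obj) (E.evaluation_surjective H.obj H.property)
        (E.inner_evaluation H.obj) (E.evaluation_lact H.obj)))
    fun {H K} T => by
      refine ObjectProperty.hom_ext _ (PreHilbertBimodule.Hom.ext (LinearMap.ext fun t => ?_))
      induction t using Submodule.Quotient.induction_on with
      | H t => exact E.evaluation_balMap T.hom t

/-- The second isomorphism concerns induction along the double conjugate of `E`; it need not be
identified with `E`, since left inverses on both levels suffice. -/
theorem rieffelRep_isEquivalence : (rieffelRep.{uR, uA, uB, uD, w} (D := D) E).IsEquivalence :=
  (equivalenceOfLeftInverses _ _ _ E.rieffelRepConjIso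
    E.conj.rieffelRepConjIso).isEquivalence_functor

end EquivalenceBimodule

end Rieffel

/-! ### Hermitian dual bases -/

namespace EquivalenceBimodule

section Span

variable {R : Type uR} [CommRing R] [LinearOrder R] [IsStrictOrderedRing R]
variable {B : Type uB} [NonUnitalRing B] [StarRing B] [Module (Cx R) B]
  [IsScalarTower (Cx R) B B] [SMulCommClass (Cx R) B B] [StarModule (Cx R) B]
variable {A : Type uA} [NonUnitalRing A] [StarRing A] [Module (Cx R) A]
  [IsScalarTower (Cx R) A A] [SMulCommClass (Cx R) A A] [StarModule (Cx R) A]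
variable (E : EquivalenceBimodule.{uR, uA, uB, w} R B A)

theorem exists_eq_sum_inner (a : A) :
    ∃ (n : ℕ) (x y : Fin n → E.carrier), a = ∑ i, E.inner (x i) (y i) := by
  have ha : a ∈ Submodule.span (Cx R) {a | ∃ x y, E.inner x y = a} :=
    E.span_inner ▸ Submodule.mem_top
  induction ha using Submodule.span_induction with
  | mem a h =>
    obtain ⟨x, y, rfl⟩ := h
    exact ⟨1, fun _ => x, fun _ => y, by simp⟩
  | zero => exact ⟨0, Fin.elim0, Fin.elim0, by simp⟩
  | add a a' _ _ h h' =>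
    obtain ⟨m, x, y, rfl⟩ := h
    obtain ⟨n, x', y', rfl⟩ := h'
    exact ⟨m + n, Fin.append x x', Fin.append y y', by simp [Fin.sum_univ_add]⟩
  | smul c a _ h =>
    obtain ⟨n, x, y, rfl⟩ := h
    -- The scalar is absorbed into the linear variable, so plain sums exhaust the span.
    exact ⟨n, x, fun i => c • y i, by simp [Finset.smul_sum]⟩

theorem exists_eq_sum_linner (b : B) :
    ∃ (n : ℕ) (x y : Fin n → E.carrier), b = ∑ i, E.linner (x i) (y i) := by
  obtain ⟨n, x, y, h⟩ := E.conj.exists_eq_sum_inner b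
  exact ⟨n, fun i => E.ofConj (x i), fun i => E.ofConj (y i), h⟩

end Span

end EquivalenceBimodule

/-- A module with a finite dual basis is finitely generated and projective. -/
theorem finite_and_projective_of_dualBasis {S M : Type*} [Ring S] [AddCommGroup M] [Module S M]
    {n : ℕ} (ξ : Fin n → M) (φ : Fin n → M →ₗ[S] S) (h : ∀ x, x = ∑ i, φ i x • ξ i) :
    Module.Finite S M ∧ Module.Projective S M := by
  have hs : Fintype.linearCombination S ξ ∘ₗ LinearMap.pi φ = LinearMap.id :=
    LinearMap.ext fun x => by simpa [Fintype.linearCombination_apply] using (h x).symm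
  exact ⟨.of_surjective (Fintype.linearCombination S ξ)
    fun x => ⟨LinearMap.pi φ x, LinearMap.congr_fun hs x⟩, .of_split _ _ hs⟩

namespace EquivalenceBimodule

section Unital

variable {R : Type uR} [CommRing R] [LinearOrder R] [IsStrictOrderedRing R]
variable {B : Type uB} [Ring B] [StarRing B] [Algebra (Cx R) B] [StarModule (Cx R) B]
variable {A : Type uA} [Ring A] [StarRing A] [Algebra (Cx R) A] [StarModule (Cx R) A]
variable (E : EquivalenceBimodule.{uR, uA, uB, w} R B A)

/-- Expand the unit of `B` in left inner products and let it act on `x`; compatibility moves each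
term to the right action. -/
theorem exists_right_dualBasis : ∃ (n : ℕ) (ξ η : Fin n → E.carrier),
    ∀ x, x = ∑ i, E.ract (E.inner (η i) x) (ξ i) := by
  obtain ⟨n, ξ, η, h⟩ := E.exists_eq_sum_linner 1
  refine ⟨n, ξ, η, fun x => ?_⟩
  conv_lhs => rw [← E.lact_one x, h]
  simp [E.linner_inner]

theorem exists_left_dualBasis : ∃ (m : ℕ) (x' y' : Fin m → E.carrier),
    ∀ x, x = ∑ j, E.lact (E.linner x (y' j)) (x' j) := by
  obtain ⟨m, y', x', h⟩ := E.exists_eq_sum_inner 1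
  refine ⟨m, x', y', fun x => ?_⟩
  conv_lhs => rw [← E.ract_one x, h]
  simp [E.linner_inner]

theorem rightModule_finite_and_projective :
    @Module.Finite Aᵐᵒᵖ E.carrier _ _ E.rightModule ∧
      @Module.Projective Aᵐᵒᵖ _ E.carrier _ E.rightModule := by
  let _ := E.rightModule
  obtain ⟨n, ξ, η, h⟩ := E.exists_right_dualBasis
  exact finite_and_projective_of_dualBasis ξ
    (fun i =>
      { toFun := fun x => MulOpposite.op (E.inner (η i) x)
        map_add' := fun x y => by simp
        map_smul' := fun a x => congrArg MulOpposite.op (E.inner_ract (η i) x a.unop) }) h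

theorem leftModule_finite_and_projective :
    @Module.Finite B E.carrier _ _ E.leftModule ∧
      @Module.Projective B _ E.carrier _ E.leftModule := by
  let _ := E.leftModule
  obtain ⟨m, x', y', h⟩ := E.exists_left_dualBasis
  exact finite_and_projective_of_dualBasis x'
    (fun j =>
      { toFun := fun x => E.linner x (y' j)
        map_add' := fun x y => by simp
        map_smul' := fun b x => E.linner_lact b x (y' j) }) h

end Unital

end EquivalenceBimodule

/-! ### Ring-theoretic Morita equivalence -/

namespace EquivalenceBimodule

section Morita

variable {R : Type uR} [CommRing R] [LinearOrder R] [IsStrictOrderedRing R]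
variable {B : Type uA} [Ring B] [StarRing B] [Algebra (Cx R) B] [StarModule (Cx R) B]
variable {A : Type uA} [Ring A] [StarRing A] [Algebra (Cx R) A] [StarModule (Cx R) A]
variable (E : EquivalenceBimodule.{uR, uA, uA, uA} R B A)

/-! ### The `B`-module `Hom_A(Ē, M)` and its double -/

section ConjHom

variable (M : Type uA) [AddCommGroup M] [Module A M]

/-- The `A`-linear maps from the conjugate bimodule of `E` to `M`. -/
def conjHom : AddSubgroup (E.carrier →+ M) where
  -- This is `A`-linearity on `Ē`, whose left action is `a · x̄ = (x · a*)‾`, written on the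
  -- elements of `E`.
  carrier := {f | ∀ a x, f (E.ract a x) = star a • f x}
  zero_mem' := by simp
  add_mem' hf hg a x := by simp [hf a x, hg a x]
  neg_mem' hf a x := by simp [hf a x]

variable {M}

@[ext]
theorem conjHom_ext {f g : E.conjHom M} (h : ∀ x, f.1 x = g.1 x) : f = g :=
  Subtype.ext (AddMonoidHom.ext h)

instance : Module B (E.conjHom M) where
  -- Precomposition with the right action of `b` on `Ē`, which is the left action of `b*` on `E`.
  smul b f := ⟨f.1.comp (E.lact (star b)).toAddMonoidHom, fun a x => by
    simp [E.lact_ract, f.2 a]⟩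
  one_smul f := E.conjHom_ext fun x => by
    change f.1 (E.lact (star 1) x) = f.1 x
    rw [star_one, E.lact_one]
  mul_smul b b' f := E.conjHom_ext fun x => by
    change f.1 (E.lact (star (b * b')) x) = f.1 (E.lact (star b') (E.lact (star b) x))
    rw [star_mul, E.lact_mul]
  smul_zero b := rfl
  smul_add b f g := rfl
  add_smul b b' f := E.conjHom_ext fun x => by
    change f.1 (E.lact (star (b + b')) x) = f.1 (E.lact (star b) x) + f.1 (E.lact (star b') x)
    simp
  zero_smul f := E.conjHom_ext fun x => by
    change f.1 (E.lact (star 0) x) = 0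
    simp

@[simp] theorem conjHom_smul_apply (b : B) (f : E.conjHom M) (x : E.carrier) :
    (b • f).1 x = f.1 (E.lact (star b) x) := rfl

@[simp] theorem conjHom_add_apply (f g : E.conjHom M) (x : E.carrier) :
    (f + g).1 x = f.1 x + g.1 x := rfl

/-- Postcomposition with an `A`-linear map. -/
def conjHomMap {N : Type uA} [AddCommGroup N] [Module A N] (g : M →ₗ[A] N) :
    E.conjHom M →ₗ[B] E.conjHom N where
  toFun f := ⟨g.toAddMonoidHom.comp f.1, fun a x => by simp [f.2 a x]⟩
  map_add' f f' := E.conjHom_ext fun x => map_add g _ _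
  map_smul' b f := rfl

/-- The map `y ↦ ⟨y, x⟩ · m`. -/
def innerSMul (x : E.carrier) (m : M) : E.conjHom M :=
  ⟨AddMonoidHom.mk' (fun y => E.inner y x • m) fun y y' => by simp [add_smul],
    fun a y => by simp [E.inner_ract_left, mul_smul]⟩

@[simp] theorem innerSMul_apply (x : E.carrier) (m : M) (y : E.carrier) :
    (E.innerSMul x m).1 y = E.inner y x • m := rfl

theorem innerSMul_add_left (x x' : E.carrier) (m : M) :
    E.innerSMul (x + x') m = E.innerSMul x m + E.innerSMul x' m :=
  E.conjHom_ext fun y => by simp [add_smul]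

theorem innerSMul_lact (b : B) (x : E.carrier) (m : M) :
    E.innerSMul (E.lact b x) m = b • E.innerSMul x m :=
  E.conjHom_ext fun y => by simp [E.inner_lact]

theorem innerSMul_ract (a : A) (x : E.carrier) (m : M) :
    E.innerSMul (E.ract a x) m = E.innerSMul x (a • m) :=
  E.conjHom_ext fun y => by simp [E.inner_ract, mul_smul]

theorem innerSMul_add_right (x : E.carrier) (m m' : M) :
    E.innerSMul x (m + m') = E.innerSMul x m + E.innerSMul x m' :=
  E.conjHom_ext fun y => by simp

/-- The map `x ↦ (y ↦ ⟨y, x⟩ · m)`. -/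
def innerSMulHom (m : M) : E.conj.conjHom (E.conjHom M) :=
  ⟨AddMonoidHom.mk' (fun x => E.innerSMul (E.ofConj x) m)
      fun x x' => by rw [map_add, innerSMul_add_left],
    fun b x => E.innerSMul_lact (star b) (E.ofConj x) m⟩

theorem innerSMulHom_apply (m : M) (x : E.conj.carrier) :
    (E.innerSMulHom m).1 x = E.innerSMul (E.ofConj x) m := rfl

theorem innerSMulHom_add (m m' : M) :
    E.innerSMulHom (m + m') = E.innerSMulHom m + E.innerSMulHom m' :=
  E.conj.conjHom_ext fun x => E.innerSMul_add_right (E.ofConj x) m m'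

theorem innerSMulHom_smul (a : A) (m : M) :
    E.innerSMulHom (a • m) = a • E.innerSMulHom m :=
  E.conj.conjHom_ext fun x => by
    rw [conjHom_smul_apply, innerSMulHom_apply, innerSMulHom_apply, ofConj_lact, star_star,
      innerSMul_ract]

variable (M) in
/-- The map `m ↦ (x ↦ (y ↦ ⟨y, x⟩ · m))`. -/
def toConjHomConjHom : M →ₗ[A] E.conj.conjHom (E.conjHom M) where
  toFun := E.innerSMulHom
  map_add' := E.innerSMulHom_add
  map_smul' := E.innerSMulHom_smul

/-- Linearity of `Φ(η)` moves `⟨y,x⟩` inside as `ξ⟨x,y⟩ = _B⟨ξ,x⟩ y`. Linearity of `Φ` then moves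
`_B⟨x,ξ⟩` onto `η`, and `_B⟨x,ξ⟩ η = x⟨ξ,η⟩`. Summed over an expansion of `1`, this recovers `Φ`
from the single element `Σ Φ(η_i)(ξ_i)`. -/
theorem inner_smul_conjHom_apply (Φ : E.conj.conjHom (E.conjHom M)) (x y ξ η : E.carrier) :
    E.inner y x • (Φ.1 (E.toConj η)).1 ξ = (Φ.1 (E.toConj (E.ract (E.inner ξ η) x))).1 y := by
  have h1 : E.ract (E.inner x y) ξ = E.lact (star (star (E.linner ξ x))) y := by
    rw [star_star, E.linner_inner]
  have h2 : E.ract (E.inner ξ η) x = E.lact (star (E.linner ξ x)) η := by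
    rw [← E.linner_star, E.linner_inner]
  rw [h2, E.inner_star y x]
  exact ((Φ.1 (E.toConj η)).2 (E.inner x y) ξ).symm.trans ((congrArg _ h1).trans
    (congrArg (fun f : E.conjHom M => f.1 y) (Φ.2 (E.linner ξ x) (E.toConj η))).symm)

/-- Evaluation at `y` as an additive map. -/
def conjHomEval (y : E.carrier) : E.conjHom M →+ M :=
  (AddMonoidHom.eval y).comp (E.conjHom M).subtype

theorem toConjHomConjHom_bijective : Function.Bijective (E.toConjHomConjHom M) := by
  obtain ⟨n, ξ, η, h⟩ := E.exists_eq_sum_inner 1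
  have hone : ∀ m : M, ∑ i, E.inner (ξ i) (η i) • m = m := fun m => by
    rw [← Finset.sum_smul, ← h, one_smul]
  have hx : ∀ x, ∑ i, E.toConj (E.ract (E.inner (ξ i) (η i)) x) = E.toConj x := fun x => by
    rw [← map_sum, ← LinearMap.sum_apply, ← map_sum, ← h, E.ract_one]
  -- Evaluating the image of `m` at all `(η_i, ξ_i)` and summing returns `m`, which gives
  -- injectivity; the same sum formed for `Φ` is its preimage.
  refine ⟨fun m m' hm => ?_, fun Φ => ⟨∑ i, (Φ.1 (E.toConj (η i))).1 (ξ i), ?_⟩⟩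
  · rw [← hone m, ← hone m']
    exact Finset.sum_congr rfl fun i _ =>
      congrArg (fun Ψ : E.conj.conjHom (E.conjHom M) => (Ψ.1 (E.toConj (η i))).1 (ξ i)) hm
  · have key : ∀ x y : E.carrier, E.inner y x • ∑ i, (Φ.1 (E.toConj (η i))).1 (ξ i) =
        (Φ.1 (E.toConj x)).1 y := fun x y => by
      rw [Finset.smul_sum]
      refine (Finset.sum_congr rfl fun i _ => E.inner_smul_conjHom_apply Φ x y _ _).trans ?_
      refine (map_sum ((E.conjHomEval y).comp Φ.1) _ _).symm.trans ?_
      exact congrArg ((E.conjHomEval y).comp Φ.1) (hx x)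
    exact E.conj.conjHom_ext fun x => E.conjHom_ext fun y => key (E.ofConj x) y

end ConjHom

/-- The functor `M ↦ Hom_A(Ē, M)` from left `A`-modules to left `B`-modules. -/
def conjHomFunctor : ModuleCat.{uA} A ⥤ ModuleCat.{uA} B where
  obj M := ModuleCat.of B (E.conjHom M)
  map g := ModuleCat.ofHom (E.conjHomMap g.hom)

/-- The functors attached to `E` and its conjugate are mutually inverse. -/
def conjHomFunctorConjIso : 𝟭 (ModuleCat.{uA} A) ≅ E.conjHomFunctor ⋙ E.conj.conjHomFunctor :=
  NatIso.ofComponents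
    (fun M => (LinearEquiv.ofBijective (E.toConjHomConjHom M)
      E.toConjHomConjHom_bijective).toModuleIso)
    fun g => ModuleCat.hom_ext <| LinearMap.ext fun m =>
      E.conj.conjHom_ext fun x => E.conjHom_ext fun y =>
        (map_smul g.hom (E.inner y (E.ofConj x)) m).symm

open scoped ModuleCat.Algebra in
theorem conjHomFunctor_linear : E.conjHomFunctor.Linear (Cx R) where
  map_smul {M N} g c := by
    refine ModuleCat.hom_ext (LinearMap.ext fun f => E.conjHom_ext fun x => ?_)
    change algebraMap (Cx R) A c • g.hom (f.1 x) =
      g.hom (f.1 (E.lact (star (algebraMap (Cx R) B c)) x))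
    -- Scalars act on the Hom module through `B` but on `M` through `A`; the two agree since both
    -- sides here are `c̄ x`.
    have h1 : E.lact (star (algebraMap (Cx R) B c)) x =
        E.ract (star (algebraMap (Cx R) A c)) x := by
      rw [Algebra.algebraMap_eq_smul_one, Algebra.algebraMap_eq_smul_one]
      simp [E.lact_one, E.ract_one]
    rw [h1, f.2, star_star, map_smul]

theorem isMoritaEquivalent (E : EquivalenceBimodule.{uR, uA, uA, uA} R B A) :
    IsMoritaEquivalent (Cx R) A B :=
  ⟨⟨⟨equivalenceOfLeftInverses _ _ _ E.conjHomFunctorConjIso.symm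
    E.conj.conjHomFunctorConjIso.symm,
    E.conjHomFunctor_linear⟩⟩⟩

end Morita

end EquivalenceBimodule

end

end StarMorita

/-! ### Assembly of the four statements -/

open StarMorita in
theorem theorem5p2 (R : Type uR) [CommRing R] [LinearOrder R] [IsStrictOrderedRing R] :
    -- (1) an equivalence relation on nondegenerate idempotent `*`-algebras
    (_root_.Equivalence fun A B : NondegIdemStarAlgebra.{uR, uA} R =>
      StronglyMoritaEquivalent R A.carrier B.carrier) ∧
    -- (2) Rieffel induction is an equivalence of categories
    (∀ (A : Type uA) [NonUnitalRing A] [StarRing A] [Module (Cx R) A]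
        [IsScalarTower (Cx R) A A] [SMulCommClass (Cx R) A A] [StarModule (Cx R) A]
        (B : Type uB) [NonUnitalRing B] [StarRing B] [Module (Cx R) B]
        [IsScalarTower (Cx R) B B] [SMulCommClass (Cx R) B B] [StarModule (Cx R) B]
        (E : EquivalenceBimodule.{uR, uA, uB, w} R B A)
        (D : Type uD) [NonUnitalRing D] [StarRing D] [Module (Cx R) D]
        [IsScalarTower (Cx R) D D] [SMulCommClass (Cx R) D D] [StarModule (Cx R) D],
      (rieffelRep (D := D) E).IsEquivalence) ∧
    -- (3) Hermitian dual bases; finitely generated projective on both sides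
    (∀ (A : Type uA) [Ring A] [StarRing A] [Algebra (Cx R) A] [StarModule (Cx R) A]
        (B : Type uB) [Ring B] [StarRing B] [Algebra (Cx R) B] [StarModule (Cx R) B]
        (E : EquivalenceBimodule.{uR, uA, uB, w} R B A),
      (∃ (n : ℕ) (ξ η : Fin n → E.carrier),
        ∀ x, x = ∑ i, E.ract (E.inner (η i) x) (ξ i)) ∧
      (∃ (m : ℕ) (x' y' : Fin m → E.carrier),
        ∀ x, x = ∑ j, E.lact (E.linner x (y' j)) (x' j)) ∧
      (@Module.Finite Aᵐᵒᵖ E.carrier _ _ E.rightModule ∧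
        @Module.Projective Aᵐᵒᵖ _ E.carrier _ E.rightModule) ∧
      (@Module.Finite B E.carrier _ _ E.leftModule ∧
        @Module.Projective B _ E.carrier _ E.leftModule)) ∧
    -- (4) ring-theoretic Morita equivalence
    (∀ (A : Type uA) [Ring A] [StarRing A] [Algebra (Cx R) A] [StarModule (Cx R) A]
        (B : Type uA) [Ring B] [StarRing B] [Algebra (Cx R) B] [StarModule (Cx R) B],
      StronglyMoritaEquivalent R A B → IsMoritaEquivalent (Cx R) A B) := by
  refine ⟨stronglyMoritaEquivalent_equivalence R, ?_, ?_, ?_⟩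
  · intro A _ _ _ _ _ _ B _ _ _ _ _ _ E D _ _ _ _ _ _
    exact E.rieffelRep_isEquivalence
  · intro A _ _ _ _ B _ _ _ _ E
    exact ⟨E.exists_right_dualBasis, E.exists_left_dualBasis, E.rightModule_finite_and_projective,
      E.leftModule_finite_and_projective⟩
  · rintro A _ _ _ _ B _ _ _ _ ⟨E⟩
    exact E.isMoritaEquivalent
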